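/- **Setting.** Identify $\mathbb C\cong\mathbb R^2$, let $Q=(0,1)\times(0,1)\subset\mathbb C$, $\Lambda=\mathbb Z+i\mathbb Z$, $m_1=\mathrm{Re}\,m$, $m_2=\mathrm{Im}\,m$ for $m\in\Lambda$, and $\mathbf Q=[-\pi,\pi]^2$. Let $\varpi\subset Q$ be a domain such that $\partial Q\subset\partial\varpi$ and $Q\setminus\mathrm{cl}(\varpi)$ contains a nonempty open set. Put $\varpi_m=\varpi+m$ and let $\Omega$ be the interior of $\bigcup_{m\in\Lambda}\mathrm{cl}(\varpi_m)$. Assume that the set $\Omega\setminus\bigcup_{m}\varpi_m$ has zero area. Write $[x]$ for the integer part of $x\in\mathbb R$, $[z]=([\mathrm{Re}\,z],[\mathrm{Im}\,z])$, $z^{\mathsf{tr}}=z-[\mathrm{Re}\,z]-i[\mathrm{Im}\,z]$, and $\eta\cdot(a,b)=\eta_1a+\eta_2b$. **Assumption $(\mathcal A)$.** There are meromorphic functions $\varphi,\phi$ on $\mathbb C$ such that $\varphi(z)=\varphi(z+1)=\varphi(z+i)$; $\varphi$ has no zeros in $\mathrm{cl}(\Omega)$ (in particular $\varphi\not\equiv0$);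 $\phi$ has only finitely many poles, all in $Q$; $\varphi(z)=\sum_{m\in\Lambda}\phi(z-m)$ for all $z\in\Omega$ that are not poles of any $\phi(\cdot-m)$; and $\sup_{z\in\Omega\setminus\mathrm{cl}(Q)}(1+|z|)^b|\phi(z)|<\infty$ for some $b>2$. **Spaces and operators.** $A^2(D)\subset L^2(D)$ is the Bergman space of an open set $D$ (area measure), whose elements are evaluated pointwise through their analytic representatives. $P_\Omega$ is the orthogonal projection of $L^2(\Omega)$ onto $A^2(\Omega)$, and $K_\Omega$ is the Bergman kernel (the reproducing kernel of $A^2(\Omega)$). For $\eta\in\mathbf Q$, $A^2_{\eta,\mathrm{ext}}(\varpi)$ is the space of those $f\in A^2(\varpi)$ that extend analytically to a neighbourhood of $\mathrm{cl}(\varpi)\cap\Omega$ in $\Omega$ and satisfy $f(1+iy)=e^{i\eta_1}f(iy)$ and $f(x+i)=e^{i\eta_2}f(x)$ for all $x,y\in(0,1)$ with $iy\in\Omega$, respectively $x\in\Omega$; $A^2_\eta(\varpi)$ is its closure in $L^2(\varpi)$, $P_\eta$ is the orthogonal projection of $L^2(\varpi)$ onto $A^2_\eta(\varpi)$, and $K_\eta(z,w)$,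 $z,w\in\varpi$, is the reproducing kernel of $A^2_\eta(\varpi)$. $L^2(\mathbf Q;A^2_\eta(\varpi))$ is the subspace of the Bochner space $L^2(\mathbf Q;L^2(\varpi))$ of functions $g$ with $g(\cdot,\eta)\in A^2_\eta(\varpi)$ for a.e. $\eta$, and $(\mathcal P g)(\cdot,\eta)=P_\eta(g(\cdot,\eta))$. The Floquet transform $\mathsf F:L^2(\Omega)\to L^2(\mathbf Q;L^2(\varpi))$ and the operator $\mathsf F^{-1}$ are $$\mathsf Ff(z,\eta)=\widehat f(z,\eta)=\frac1{2\pi}\sum_{m\in\Lambda}e^{-i\eta_1m_1-i\eta_2m_2}f(z+m),\qquad \mathsf F^{-1}g(z)=\frac1{2\pi}\int_{\mathbf Q}e^{i\eta\cdot[z]}g(z^{\mathsf{tr}},\eta)\,d\eta,$$ where the series converges in $L^2(\mathbf Q;L^2(\varpi))$ and the integral is, on each $\varpi_m$, an $L^2(\varpi)$-valued Bochner integral. **Theorem.** Under the above assumptions: (i) $\mathcal P$ is well defined on $L^2(\mathbf Q;L^2(\varpi))$ (for every $g$ in this space, $\eta\mapsto P_\eta(g(\cdot,\eta))$ is measurable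 and square integrable), and $\mathcal P$ is the orthogonal projection of $L^2(\mathbf Q;L^2(\varpi))$ onto $L^2(\mathbf Q;A^2_\eta(\varpi))$. For all $\eta\in\mathbf Q$ and $z\in\varpi$, $K_\eta(z,\cdot)\in L^2(\varpi)$ and $P_\eta f(z)=\int_\varpi K_\eta(z,w)f(w)\,dA(w)$ for every $f\in L^2(\varpi)$. (ii) For every $f\in L^2(\Omega)$ one has $\mathsf F P_\Omega f=\mathcal P\mathsf F f$ and $P_\Omega f=\mathsf F^{-1}\mathcal P\mathsf Ff$ a.e. in $\Omega$. Moreover, for every $z\in\Omega$ with $z^{\mathsf{tr}}\in\varpi$ (hence for a.e. $z\in\Omega$), $$P_\Omega f(z)=\frac1{2\pi}\int_{\mathbf Q}e^{i\eta\cdot[z]}\big(P_\eta\widehat f(\cdot,\eta)\big)(z^{\mathsf{tr}})\,d\eta=\frac1{4\pi^2}\int_\Omega\int_{\mathbf Q}e^{i\eta\cdot([z]-[w])}K_\eta(z^{\mathsf{tr}},w^{\mathsf{tr}})f(w)\,d\eta\,dA(w),$$ where the first integrand is integrable and, in the iterated integral, the integral over $\eta$ is taken first. For all $z,w\in\Omega$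 with $z^{\mathsf{tr}},w^{\mathsf{tr}}\in\varpi$ the function $\eta\mapsto K_\eta(z^{\mathsf{tr}},w^{\mathsf{tr}})$ is integrable over $\mathbf Q$ and $$K_\Omega(z,w)=\frac1{4\pi^2}\int_{\mathbf Q}e^{i\eta\cdot([z]-[w])}K_\eta(z^{\mathsf{tr}},w^{\mathsf{tr}})\,d\eta,$$ and for each such $z$ the right-hand side, as a function of $w$, belongs to $L^2(\Omega)$. -/

import Mathlib

open MeasureTheory Filter Topology Set
open scoped ENNReal

noncomputable section

namespace FloquetBergman

/-! ## Periodic cell and periodic domain -/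

/-- The open unit square `(0,1) × (0,1)`, as a subset of `ℂ`. -/
def unitSquare : Set ℂ := {z | z.re ∈ Ioo (0 : ℝ) 1 ∧ z.im ∈ Ioo (0 : ℝ) 1}

/-- The lattice point `m₁ + i m₂`. -/
def lat (m : ℤ × ℤ) : ℂ := ⟨m.1, m.2⟩

/-- The translate `A + (m₁ + i m₂)`. -/
def cellTranslate (A : Set ℂ) (m : ℤ × ℤ) : Set ℂ := (fun z => z + lat m) '' A

/-- `ϖ` is a periodic cell: a domain in the open unit square whose boundary contains the boundary
of the square and such that the complement of its closure in the square contains a (nonempty)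
open set. -/
structure IsPeriodicCell (ϖ : Set ℂ) : Prop where
  isOpen : IsOpen ϖ
  isConnected : IsConnected ϖ
  subset_unitSquare : ϖ ⊆ unitSquare
  frontier_subset : frontier unitSquare ⊆ frontier ϖ
  exists_hole : ∃ U : Set ℂ, IsOpen U ∧ U.Nonempty ∧ U ⊆ unitSquare \ closure ϖ

/-- The doubly periodic domain generated by the cell `ϖ`: the interior of the union of the closures
of all the translates of `ϖ`. -/
def periodicDomain (ϖ : Set ℂ) : Set ℂ := interior (⋃ m : ℤ × ℤ, closure (cellTranslate ϖ m))

theorem isOpen_periodicDomain (ϖ : Set ℂ) : IsOpen (periodicDomain ϖ) := isOpen_interior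

/-- The set of poles of a meromorphic function. -/
def poles (f : ℂ → ℂ) : Set ℂ := {z | meromorphicOrderAt f z < 0}

/-- Condition `(𝒜)`. Meromorphic functions are functions `ℂ → ℂ` in normal form: analytic
except at their poles, where by convention they take the value `0`. The series is only required to
represent `Φ` at points of the periodic domain that are not poles of one of its terms. -/
def ConditionA (ϖ : Set ℂ) : Prop :=
  ∃ Φ φ : ℂ → ℂ,
    -- `Φ` is an elliptic function with periods `1` and `i`
    MeromorphicNFOn Φ univ ∧ (∀ z, Φ (z + 1) = Φ z) ∧ (∀ z, Φ (z + Complex.I) = Φ z) ∧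
    -- `Φ` has no zeros in the closure of the periodic domain
    (∀ z ∈ closure (periodicDomain ϖ), meromorphicOrderAt Φ z ≤ 0) ∧
    -- `φ` is meromorphic, with finitely many poles, all of them in the open unit square
    MeromorphicNFOn φ univ ∧ (poles φ).Finite ∧ poles φ ⊆ unitSquare ∧
    (∀ z ∈ periodicDomain ϖ, (∀ m, z - lat m ∉ poles φ) →
      HasSum (fun m : ℤ × ℤ => φ (z - lat m)) (Φ z)) ∧
    ∃ b d : ℝ, 2 < b ∧ ∀ z ∈ periodicDomain ϖ \ closure unitSquare, (1 + ‖z‖) ^ b * ‖φ z‖ ≤ d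

/-! ## Bergman spaces, Bergman projections, reproducing kernels -/

/-- `L²(D)` with respect to the area measure. -/
abbrev L2 (D : Set ℂ) : Type := Lp ℂ 2 (volume.restrict D)

/-- Sub-mean value inequality for `|f|²` over a disc (with a non-optimal constant). -/
theorem area_sub_mean {f : ℂ → ℂ} {c : ℂ} {R : ℝ} (hR : 0 < R)
    (hf : DifferentiableOn ℂ f (Metric.ball c R)) :
    ENNReal.ofReal (R ^ 2 / 2) * ‖f c‖ₑ ^ 2 ≤ ∫⁻ w in Metric.ball c R, ‖f w‖ₑ ^ 2 := by
  have hcirc : ∀ r ∈ Ioo 0 R, ‖f c‖ₑ ^ 2 ≤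
      ∫⁻ θ in Ioo (-Real.pi) Real.pi, ‖f (c + r * (Real.cos θ + Real.sin θ * Complex.I))‖ₑ ^ 2 := by
    intro r hr
    have hd : DiffContOnCl ℂ (fun z => f z ^ 2) (Metric.ball c |r|) := by
      have : DifferentiableOn ℂ (fun z => f z ^ 2) (Metric.ball c R) := hf.pow 2
      rw [abs_of_pos hr.1]
      apply DifferentiableOn.diffContOnCl
      apply this.mono
      rw [closure_ball _ hr.1.ne']
      exact Metric.closedBall_subset_ball hr.2
    have h1 := hd.circleAverage
    have hper : Function.Periodic (fun θ => f (circleMap c r θ) ^ 2) (2 * Real.pi) := by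
      intro θ
      simp only [periodic_circleMap c r θ]
    rw [Real.circleAverage_def] at h1
    have h2 := hper.intervalIntegral_add_eq 0 (-Real.pi)
    rw [zero_add, show -Real.pi + 2 * Real.pi = Real.pi by ring] at h2
    rw [h2, intervalIntegral.integral_of_le (by linarith [Real.pi_pos]),
      integral_Ioc_eq_integral_Ioo] at h1
    have h3 : ‖f c‖ₑ ^ 2 = ‖f c ^ 2‖ₑ := by simp [enorm_pow]
    rw [h3, ← h1]
    calc ‖(2 * Real.pi)⁻¹ • ∫ θ in Ioo (-Real.pi) Real.pi, f (circleMap c r θ) ^ 2‖ₑ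
        ≤ 1 * ‖∫ θ in Ioo (-Real.pi) Real.pi, f (circleMap c r θ) ^ 2‖ₑ := by
          rw [enorm_smul]
          gcongr
          rw [Real.enorm_eq_ofReal (by positivity)]
          rw [ENNReal.ofReal_le_one]
          apply inv_le_one_of_one_le₀
          linarith [Real.pi_gt_three]
      _ ≤ ∫⁻ θ in Ioo (-Real.pi) Real.pi, ‖f (circleMap c r θ) ^ 2‖ₑ := by
          rw [one_mul]; exact enorm_integral_le_lintegral_enorm _
      _ = _ := by
          refine lintegral_congr fun θ => ?_
          rw [enorm_pow, circleMap, Complex.exp_mul_I]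
          simp
  set F : ℂ → ℝ≥0∞ := fun w => (Metric.ball c R).indicator (fun w => ‖f w‖ₑ ^ 2) (c + w) with hF
  have e1 : ∫⁻ w in Metric.ball c R, ‖f w‖ₑ ^ 2 = ∫⁻ w, F w := by
    rw [← lintegral_indicator Metric.isOpen_ball.measurableSet, hF,
      lintegral_add_left_eq_self (fun w => (Metric.ball c R).indicator (fun w => ‖f w‖ₑ ^ 2) w) c]
  have hFm : Measurable F := by
    have hm : Measurable ((Metric.ball c R).indicator (fun w => ‖f w‖ₑ ^ 2)) := by
      have hc : ContinuousOn (fun w => ‖f w‖ₑ ^ 2) (Metric.ball c R) := by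
        have := hf.continuousOn.enorm
        exact (ENNReal.continuous_pow 2).comp_continuousOn this
      classical
      have := hc.measurable_piecewise (g := 0) continuousOn_const
        Metric.isOpen_ball.measurableSet
      rwa [Set.piecewise_eq_indicator] at this
    exact hm.comp (measurable_const_add c)
  rw [e1, ← Complex.lintegral_comp_polarCoord_symm]
  have hsub : Ioo 0 R ×ˢ Ioo (-Real.pi) Real.pi ⊆ polarCoord.target := by
    rw [polarCoord_target]
    exact prod_mono Ioo_subset_Ioi_self subset_rfl
  refine le_trans ?_ (lintegral_mono_set hsub)
  rw [Measure.volume_eq_prod, ← Measure.prod_restrict]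
  have hmeas : Measurable fun p : ℝ × ℝ => ENNReal.ofReal p.1 • F (Complex.polarCoord.symm p) := by
    simp only [smul_eq_mul]
    refine Measurable.mul (by fun_prop) (hFm.comp ?_)
    have : (fun p : ℝ × ℝ => Complex.polarCoord.symm p) =
      fun p : ℝ × ℝ => (p.1 * (Real.cos p.2 + Real.sin p.2 * Complex.I) : ℂ) := by
      funext p; exact Complex.polarCoord_symm_apply p
    change Measurable fun p : ℝ × ℝ => Complex.polarCoord.symm p
    rw [this]; fun_prop
  rw [lintegral_prod _ hmeas.aemeasurable]
  have hin : ∀ r ∈ Ioo 0 R, ENNReal.ofReal r * ‖f c‖ₑ ^ 2 ≤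
      ∫⁻ θ in Ioo (-Real.pi) Real.pi, ENNReal.ofReal r • F (Complex.polarCoord.symm (r, θ)) := by
    intro r hr
    simp only [smul_eq_mul]
    rw [lintegral_const_mul' _ _ ENNReal.ofReal_ne_top]
    gcongr
    refine (hcirc r hr).trans (le_of_eq ?_)
    refine lintegral_congr fun θ => ?_
    simp only [hF, Complex.polarCoord_symm_apply]
    rw [indicator_of_mem]
    rw [Complex.ofReal_cos, Complex.ofReal_sin, ← Complex.exp_mul_I]
    simp [Complex.norm_exp_ofReal_mul_I, abs_of_pos hr.1, hr.2]
  refine le_trans (le_of_eq ?_) (setLIntegral_mono' measurableSet_Ioo hin)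
  rw [lintegral_mul_const' _ _ (by simp)]
  congr 1
  rw [← ofReal_integral_eq_lintegral_ofReal]
  · rw [← integral_Ioc_eq_integral_Ioo, ← intervalIntegral.integral_of_le hR.le, integral_id]
    simp
  · exact (continuous_id.integrableOn_Icc (a := 0) (b := R)).mono_set Ioo_subset_Icc_self
  · filter_upwards [ae_restrict_mem measurableSet_Ioo] with r hr using hr.1.le

/-- The square integrable holomorphic functions form a closed subspace. -/
theorem isClosed_bergman {D : Set ℂ} (hD : IsOpen D) :
    IsClosed {f : Lp ℂ 2 (volume.restrict D) |
      ∃ g : ℂ → ℂ, DifferentiableOn ℂ g D ∧ f =ᵐ[volume.restrict D] g} := by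
  refine IsSeqClosed.isClosed fun u f hu hf => ?_
  choose g hg hug using hu
  -- the holomorphic representatives are locally uniformly Cauchy
  have hest : ∀ c R, 0 < R → Metric.ball c R ⊆ D → ∀ m n,
      ENNReal.ofReal (R ^ 2 / 2) * ‖g m c - g n c‖ₑ ^ 2 ≤ ENNReal.ofReal (dist (u m) (u n)) ^ 2 := by
    intro c R hR hcR m n
    refine (area_sub_mean hR (((hg m).sub (hg n)).mono hcR)).trans ?_
    refine (lintegral_mono_set hcR).trans (le_of_eq ?_)
    rw [← edist_dist, Lp.edist_def, eLpNorm_eq_lintegral_rpow_enorm_toReal (by simp) (by simp)]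
    simp only [ENNReal.toReal_ofNat, ENNReal.rpow_ofNat]
    rw [← ENNReal.rpow_natCast, ← ENNReal.rpow_mul]
    norm_num
    refine lintegral_congr_ae ?_
    filter_upwards [hug m, hug n] with w h1 h2
    simp [h1, h2]
  have hloc : ∀ x ∈ D, ∃ r > 0, Metric.ball x r ⊆ D ∧ UniformCauchySeqOn g atTop (Metric.ball x r) := by
    intro x hx
    obtain ⟨R, hR, hxR⟩ := Metric.isOpen_iff.1 hD x hx
    refine ⟨R / 2, by positivity, (Metric.ball_subset_ball (by linarith)).trans hxR, ?_⟩
    rw [Metric.uniformCauchySeqOn_iff]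
    intro ε hε
    obtain ⟨N, hN⟩ := Metric.cauchySeq_iff.1 hf.cauchySeq (ε * (R / 4)) (by positivity)
    refine ⟨N, fun m hm n hn c hc => ?_⟩
    have h1 := hest c (R / 2) (by positivity) (by
      intro y hy
      apply hxR
      rw [Metric.mem_ball] at *
      linarith [dist_triangle y c x]) m n
    have h2 : (R / 2) ^ 2 / 2 * dist (g m c) (g n c) ^ 2 ≤ dist (u m) (u n) ^ 2 := by
      rw [← ofReal_norm, ← dist_eq_norm, ← ENNReal.ofReal_pow dist_nonneg,
        ← ENNReal.ofReal_pow dist_nonneg, ← ENNReal.ofReal_mul (by positivity)] at h1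
      exact (ENNReal.ofReal_le_ofReal_iff (by positivity)).1 h1
    have h3 := hN m hm n hn
    have h4 : dist (u m) (u n) ^ 2 < (ε * (R / 4)) ^ 2 := by
      gcongr
    by_contra! h5
    have h6 : ε ^ 2 ≤ dist (g m c) (g n c) ^ 2 := by gcongr
    have h7 : (R / 2) ^ 2 / 2 * ε ^ 2 ≤ (R / 2) ^ 2 / 2 * dist (g m c) (g n c) ^ 2 := by gcongr
    nlinarith [sq_nonneg (R * ε)]
  have hpt : ∀ x, ∃ y, x ∈ D → Tendsto (fun n => g n x) atTop (𝓝 y) := by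
    intro x
    by_cases hx : x ∈ D
    · obtain ⟨r, hr, -, hc⟩ := hloc x hx
      obtain ⟨y, hy⟩ := cauchySeq_tendsto_of_complete (hc.cauchySeq (Metric.mem_ball_self hr))
      exact ⟨y, fun _ => hy⟩
    · exact ⟨0, fun h => absurd h hx⟩
  choose G hG using hpt
  have hlu : TendstoLocallyUniformlyOn g G atTop D := by
    rw [Metric.tendstoLocallyUniformlyOn_iff]
    intro ε hε x hx
    obtain ⟨r, hr, hrD, hc⟩ := hloc x hx
    refine ⟨Metric.ball x r, mem_nhdsWithin_of_mem_nhds (Metric.ball_mem_nhds x hr), ?_⟩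
    exact Metric.tendstoUniformlyOn_iff.1
      (hc.tendstoUniformlyOn_of_tendsto fun y hy => hG y (hrD hy)) ε hε
  refine ⟨G, hlu.differentiableOn (Eventually.of_forall hg) hD, ?_⟩
  obtain ⟨ns, hns, hae⟩ := (tendstoInMeasure_of_tendsto_Lp hf).exists_seq_tendsto_ae
  have hall : ∀ᵐ w ∂(volume.restrict D), ∀ n, u n w = g n w := ae_all_iff.2 hug
  filter_upwards [hae, hall, ae_restrict_mem hD.measurableSet] with w h1 h2 h3
  refine tendsto_nhds_unique h1 ?_
  simp only [h2]
  exact (hG w h3).comp hns.tendsto_atTop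

/-- Fibrewise membership in closed sets is a closed condition in the Bochner space. -/
theorem isClosed_fiber {α E : Type*} [MeasurableSpace α] {μ : Measure α} [NormedAddCommGroup E]
    {K : α → Set E} (hK : ∀ a, IsClosed (K a)) :
    IsClosed {f : Lp E 2 μ | ∀ᵐ a ∂μ, f a ∈ K a} := by
  refine IsSeqClosed.isClosed fun u f hu hf => ?_
  obtain ⟨ns, -, hae⟩ := (tendstoInMeasure_of_tendsto_Lp hf).exists_seq_tendsto_ae
  have hall : ∀ᵐ a ∂μ, ∀ n, u n a ∈ K a := ae_all_iff.2 hu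
  filter_upwards [hae, hall] with a h1 h2
  exact (hK a).mem_of_tendsto h1 (Eventually.of_forall fun n => h2 _)

/-- The Bergman space `A²(D)` of an open set `D`, as a subspace of `L²(D)`. -/
def bergmanSpace (D : Set ℂ) : Submodule ℂ (L2 D) where
  carrier := {f | ∃ g : ℂ → ℂ, DifferentiableOn ℂ g D ∧ f =ᵐ[volume.restrict D] g}
  zero_mem' := ⟨0, differentiableOn_const 0, Lp.coeFn_zero _ _ _⟩
  add_mem' := by
    rintro f₁ f₂ ⟨g₁, h₁, e₁⟩ ⟨g₂, h₂, e₂⟩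
    exact ⟨g₁ + g₂, h₁.add h₂, (Lp.coeFn_add f₁ f₂).trans (e₁.add e₂)⟩
  smul_mem' := by
    rintro c f ⟨g, h, e⟩
    exact ⟨c • g, h.const_smul c, (Lp.coeFn_smul c f).trans (e.const_smul c)⟩

theorem hasOrthogonalProjection_bergmanSpace {D : Set ℂ} (hD : IsOpen D) :
    (bergmanSpace D).HasOrthogonalProjection := by
  have : CompleteSpace (bergmanSpace D) := (isClosed_bergman hD).isComplete.completeSpace_coe
  infer_instance

/-- The Bergman projection: the orthogonal projection of `L²(D)` onto `A²(D)`, `D` open. -/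
def bergmanProj (D : Set ℂ) (hD : IsOpen D) : L2 D →L[ℂ] L2 D :=
  haveI := hasOrthogonalProjection_bergmanSpace hD
  (bergmanSpace D).starProjection

open Classical in
/-- The pointwise values `f(z)`, `z ∈ D`, of an element `f` of `A²(D)`: the values of its holomorphic
representative, which is unique on the open set `D`. (Set to `0` off `D`, and for `f ∉ A²(D)`.) -/
def holoRep (D : Set ℂ) (f : L2 D) : ℂ → ℂ :=
  if h : ∃ g : ℂ → ℂ, DifferentiableOn ℂ g D ∧ f =ᵐ[volume.restrict D] g then D.indicator h.choose
  else 0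

open Classical in
/-- The Riesz representative in `K` of the evaluation `f ↦ f(z)` on a subspace `K` of
`A²(D)`; it is unique. (Set to `0` if there is none.) -/
def evalVec {D : Set ℂ} (K : Submodule ℂ (L2 D)) (z : ℂ) : L2 D :=
  if h : ∃ k ∈ K, ∀ f ∈ K, inner ℂ k f = holoRep D f z then h.choose else 0

/-- The reproducing kernel `K(z,w)`, `z, w ∈ D`, of a closed subspace of `A²(D)`: the function
`K(z,·)` is the complex conjugate of the Riesz representative of the evaluation at `z`, so that
`∫ K(z,w) f(w) dA(w)` is the value at `z` of the orthogonal projection of `f`. -/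
def reproKernel {D : Set ℂ} (K : Submodule ℂ (L2 D)) (z w : ℂ) : ℂ :=
  starRingEnd ℂ (holoRep D (evalVec K z) w)

/-! ## Quasiperiodic Bergman spaces on the cell -/

/-- The space `A²_{η,ext}(ϖ)` of the functions in `A²(ϖ)` that extend analytically to a
neighbourhood `V` of `cl(ϖ) ∩ Ω` in `Ω` and satisfy the quasiperiodic boundary conditions (on the
part of the boundary of the square that lies in `Ω`, where the extension is defined). -/
def quasiExt (ϖ : Set ℂ) (η : ℝ × ℝ) : Submodule ℂ (L2 ϖ) where
  carrier := {f | f ∈ bergmanSpace ϖ ∧ ∃ (V : Set ℂ) (g : ℂ → ℂ), IsOpen V ∧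
    closure ϖ ∩ periodicDomain ϖ ⊆ V ∧ V ⊆ periodicDomain ϖ ∧
    DifferentiableOn ℂ g V ∧ f =ᵐ[volume.restrict ϖ] g ∧
    (∀ y ∈ Ioo (0 : ℝ) 1, (y * Complex.I : ℂ) ∈ periodicDomain ϖ →
      g (1 + y * Complex.I) = Complex.exp (Complex.I * η.1) * g (y * Complex.I)) ∧
    (∀ x ∈ Ioo (0 : ℝ) 1, (x : ℂ) ∈ periodicDomain ϖ →
      g (x + Complex.I) = Complex.exp (Complex.I * η.2) * g x)}
  zero_mem' := ⟨zero_mem _, periodicDomain ϖ, 0, isOpen_periodicDomain ϖ, inter_subset_right,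
    subset_rfl, differentiableOn_const 0, Lp.coeFn_zero _ _ _, by simp, by simp⟩
  add_mem' := by
    rintro f₁ f₂ ⟨b₁, V₁, g₁, o₁, s₁, t₁, d₁, e₁, p₁, q₁⟩ ⟨b₂, V₂, g₂, o₂, s₂, t₂, d₂, e₂, p₂, q₂⟩
    refine ⟨add_mem b₁ b₂, V₁ ∩ V₂, g₁ + g₂, o₁.inter o₂, subset_inter s₁ s₂,
      inter_subset_left.trans t₁, (d₁.mono inter_subset_left).add (d₂.mono inter_subset_right),
      (Lp.coeFn_add f₁ f₂).trans (e₁.add e₂), fun y hy h => ?_, fun x hx h => ?_⟩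
    · simp only [Pi.add_apply, p₁ y hy h, p₂ y hy h, mul_add]
    · simp only [Pi.add_apply, q₁ x hx h, q₂ x hx h, mul_add]
  smul_mem' := by
    rintro c f ⟨b, V, g, o, s, t, d, e, p, q⟩
    refine ⟨Submodule.smul_mem _ c b, V, c • g, o, s, t, d.const_smul c,
      (Lp.coeFn_smul c f).trans (e.const_smul c), fun y hy h => ?_, fun x hx h => ?_⟩
    · simp only [Pi.smul_apply, p y hy h, smul_eq_mul]; ring
    · simp only [Pi.smul_apply, q x hx h, smul_eq_mul]; ring

/-- The space `A²_η(ϖ)`, the closure of `A²_{η,ext}(ϖ)`. -/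
def quasiSpace (ϖ : Set ℂ) (η : ℝ × ℝ) : Submodule ℂ (L2 ϖ) := (quasiExt ϖ η).topologicalClosure

instance (ϖ : Set ℂ) (η : ℝ × ℝ) : CompleteSpace (quasiSpace ϖ η) :=
  inferInstanceAs (CompleteSpace (quasiExt ϖ η).topologicalClosure)

/-- `P_η`, the orthogonal projection of `L²(ϖ)` onto `A²_η(ϖ)`. -/
def cellProj (ϖ : Set ℂ) (η : ℝ × ℝ) : L2 ϖ →L[ℂ] L2 ϖ := (quasiSpace ϖ η).starProjection

/-- `K_η`, the kernel of `P_η`. -/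
def cellKernel (ϖ : Set ℂ) (η : ℝ × ℝ) (z w : ℂ) : ℂ := reproKernel (quasiSpace ϖ η) z w

/-! ## Bochner spaces over the Floquet parameter -/

/-- The set `𝐐 = [-π, π]²` of Floquet parameters. -/
def floquetSquare : Set (ℝ × ℝ) := Icc (-Real.pi) Real.pi ×ˢ Icc (-Real.pi) Real.pi

/-- Lebesgue measure on `𝐐`. -/
def floquetMeasure : Measure (ℝ × ℝ) := volume.restrict floquetSquare

instance : IsFiniteMeasure floquetMeasure :=
  isFiniteMeasure_restrict.2 (isCompact_Icc.prod isCompact_Icc).measure_lt_top.ne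

/-- The Bochner space `L²(𝐐; L²(ϖ))`. -/
abbrev BochnerL2 (ϖ : Set ℂ) : Type := Lp (L2 ϖ) 2 floquetMeasure

/-- `L²(𝐐; A²_η(ϖ))`: the functions with `g(·, η) ∈ A²_η(ϖ)` for almost every `η ∈ 𝐐`. -/
def fiberSpace (ϖ : Set ℂ) : Submodule ℂ (BochnerL2 ϖ) where
  carrier := {g | ∀ᵐ η ∂floquetMeasure, g η ∈ quasiSpace ϖ η}
  zero_mem' := by
    filter_upwards [Lp.coeFn_zero (L2 ϖ) 2 floquetMeasure] with η h
    rw [h]; exact zero_mem _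
  add_mem' := by
    intro g₁ g₂ h₁ h₂
    filter_upwards [h₁, h₂, Lp.coeFn_add g₁ g₂] with η a b h
    rw [h]; exact add_mem a b
  smul_mem' := by
    intro c g h₁
    filter_upwards [h₁, Lp.coeFn_smul c g] with η a h
    rw [h]; exact Submodule.smul_mem _ c a

instance (ϖ : Set ℂ) : CompleteSpace (fiberSpace ϖ) :=
  (isClosed_fiber (K := fun η => (quasiSpace ϖ η : Set (L2 ϖ)))
    fun _ => Submodule.isClosed_topologicalClosure _).isComplete.completeSpace_coe

open Classical in
/-- The fibrewise operator `(𝒫 g)(·, η) = P_η (g(·, η))` (set to `0` if the right-hand side is not a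
square integrable function of `η`). -/
def fiberProj (ϖ : Set ℂ) (g : BochnerL2 ϖ) : BochnerL2 ϖ :=
  if h : MemLp (fun η => cellProj ϖ η (g η)) 2 floquetMeasure then h.toLp else 0

/-! ## Floquet transform -/

/-- The pairing `m₁ η₁ + m₂ η₂`. -/
def pairing (m : ℤ × ℤ) (η : ℝ × ℝ) : ℝ := m.1 * η.1 + m.2 * η.2

theorem memLp_cellPart (ϖ : Set ℂ) (m : ℤ × ℤ) (f : L2 (periodicDomain ϖ)) :
    MemLp (fun z => (periodicDomain ϖ).indicator f (z + lat m)) 2 (volume.restrict ϖ) := by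
  have h : MemLp ((periodicDomain ϖ).indicator f) 2 volume :=
    (memLp_indicator_iff_restrict (isOpen_periodicDomain ϖ).measurableSet).2 (Lp.memLp f)
  exact (h.comp_measurePreserving (measurePreserving_add_right volume (lat m))).restrict ϖ

/-- The function `z ↦ f(z + m)` on the cell `ϖ`, for `f ∈ L²(Ω)`. -/
def cellPart (ϖ : Set ℂ) (m : ℤ × ℤ) (f : L2 (periodicDomain ϖ)) : L2 ϖ := (memLp_cellPart ϖ m f).toLp

theorem memLp_mode (ϖ : Set ℂ) (m : ℤ × ℤ) (h : L2 ϖ) :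
    MemLp (fun η => Complex.exp (-(Complex.I * pairing m η)) • h) 2 floquetMeasure := by
  refine MemLp.of_bound (C := ‖h‖) ?_ (Eventually.of_forall fun η => ?_)
  · refine Continuous.aestronglyMeasurable ?_
    unfold pairing
    fun_prop
  · rw [norm_smul, Complex.norm_exp]; simp

/-- The Floquet transform `F : L²(Ω) → L²(𝐐; L²(ϖ))`,
`(F f)(z, η) = (2π)⁻¹ ∑ₘ exp(-i(η₁m₁ + η₂m₂)) f(z + m)`, where the series converges in the Bochner
space. -/
def floquet (ϖ : Set ℂ) (f : L2 (periodicDomain ϖ)) : BochnerL2 ϖ :=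
  (1 / (2 * Real.pi) : ℂ) • ∑' m : ℤ × ℤ, (memLp_mode ϖ m (cellPart ϖ m f)).toLp

/-- The integer parts `([Re z], [Im z])`. -/
def intPart (z : ℂ) : ℤ × ℤ := (⌊z.re⌋, ⌊z.im⌋)

/-- `z^tr = z - [Re z] - i [Im z]`. -/
def tr (z : ℂ) : ℂ := z - lat (intPart z)

/-- The inverse Floquet transform
`(F⁻¹ g)(z) = (2π)⁻¹ ∫_𝐐 exp(i([Re z]η₁ + [Im z]η₂)) g(z^tr, η) dη`. For each of the countably many
values of `([Re z], [Im z])` the integral is a Bochner integral with values in `L²(ϖ)`; hence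
`F⁻¹ g` is determined up to null sets. -/
def floquetInv (ϖ : Set ℂ) (g : BochnerL2 ϖ) (z : ℂ) : ℂ :=
  ((1 / (2 * Real.pi) : ℂ) •
    ∫ η, Complex.exp (Complex.I * pairing (intPart z) η) • g η ∂floquetMeasure : L2 ϖ) (tr z)

end FloquetBergman

end

open FloquetBergman

noncomputable section

namespace FloquetBergman

/-! The normalized modes `(2π)⁻¹ exp(-i η·m)` are orthonormal on `𝐐`, so the Floquet transform `F`
is an isometry, and `F* F = 1`. Testing against functions supported in one cell identifies `F*` with
the integral `F⁻¹` (`floquetInv_ae_eq`); surjectivity of `F` is never needed. The theorem reduces to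
two inclusions: `F` maps `A²(Ω)` into the fibre space `L²(𝐐; A²_η(ϖ))`, and `A²(Ω)ᗮ` into its
orthogonal complement. Then `F P_Ω = 𝒫 F`, and applying `F*` gives `P_Ω = F* 𝒫 F`.

Both inclusions rest on the quotient `Ψ` of the two functions in `(𝒜)`: it is holomorphic on `Ω`,
its bounds on the cells are summable, and its lattice translates add up to `1`
(`ConditionA.exists_partition`). Multiplying by `Ψ(· - p)` shows that functions with summable cell
norms are dense in `A²(Ω)`. For such `U` the Floquet series converges for every `η` to a
quasiperiodic holomorphic function, the section of `U`, so density gives the first inclusion.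
Conversely, an element of `A²_{η,ext}(ϖ)` extends to a quasiperiodic `G` on `Ω`, and the section of
`G Ψ` at `η` is `G ∑ Ψ(· + l) = G`. Sections thus fill every `A²_{η,ext}(ϖ)`, and orthogonality to
all sections cut off to measurable sets of `η` is fibrewise orthogonality
(`ae_inner_quasiSpace_eq_zero`). As `F*` sends a cut-off section to a holomorphic lattice sum, the
second inclusion follows by duality.

The kernel formulas hold because evaluation at `x ∈ ϖ` is the inner product with one vector of
`A²(ϖ)`, the same for all `η`: it passes through Bochner integrals, and its image under `P_η`
represents evaluation on `A²_η(ϖ)`. -/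

theorem eLpNorm_two_sq {α E : Type*} [MeasurableSpace α] [NormedAddCommGroup E] (f : α → E)
    (μ : Measure α) : eLpNorm f 2 μ ^ 2 = ∫⁻ x, ‖f x‖ₑ ^ 2 ∂μ := by
  have := eLpNorm_nnreal_pow_eq_lintegral (f := f) (μ := μ) (p := 2) (by norm_num)
  norm_num at this
  exact_mod_cast this

theorem enorm_Lp_two_sq {α E : Type*} [MeasurableSpace α] [NormedAddCommGroup E] {μ : Measure α}
    (f : Lp E 2 μ) : ‖f‖ₑ ^ 2 = ∫⁻ x, ‖f x‖ₑ ^ 2 ∂μ := by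
  rw [Lp.enorm_def, eLpNorm_two_sq]

/-! ### Point evaluations and reproducing kernels in Bergman spaces. -/

theorem holoRep_spec {D : Set ℂ} (hD : IsOpen D) {f : L2 D} (hf : f ∈ bergmanSpace D) :
    DifferentiableOn ℂ (holoRep D f) D ∧ f =ᵐ[volume.restrict D] holoRep D f := by
  have h : ∃ g : ℂ → ℂ, DifferentiableOn ℂ g D ∧ f =ᵐ[volume.restrict D] g := hf
  simp only [holoRep, dif_pos h]
  obtain ⟨h1, h2⟩ := h.choose_spec
  refine ⟨h1.congr fun x hx => indicator_of_mem hx _, ?_⟩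
  filter_upwards [h2, ae_restrict_mem hD.measurableSet] with w h3 h4
  rw [h3, indicator_of_mem h4]

theorem mem_bergmanSpace {D : Set ℂ} {f : L2 D} {g : ℂ → ℂ} (hg : DifferentiableOn ℂ g D)
    (hfg : f =ᵐ[volume.restrict D] g) : f ∈ bergmanSpace D := ⟨g, hg, hfg⟩

theorem holoRep_eq {D : Set ℂ} (hD : IsOpen D) {f : L2 D} {g : ℂ → ℂ}
    (hg : DifferentiableOn ℂ g D) (hfg : f =ᵐ[volume.restrict D] g) {z : ℂ} (hz : z ∈ D) :
    holoRep D f z = g z := by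
  obtain ⟨h1, h2⟩ := holoRep_spec hD (mem_bergmanSpace hg hfg)
  exact Measure.eqOn_open_of_ae_eq (h2.symm.trans hfg) hD h1.continuousOn hg.continuousOn hz

theorem sq_norm_holomorphic_le {g : ℂ → ℂ} {c : ℂ} {R : ℝ} (hR : 0 < R)
    (hg : DifferentiableOn ℂ g (Metric.ball c R)) {b : ℝ} (hb : 0 ≤ b)
    (h : ∫⁻ w in Metric.ball c R, ‖g w‖ₑ ^ 2 ≤ ENNReal.ofReal b ^ 2) :
    ‖g c‖ ≤ 2 / R * b := by
  have h1 := (area_sub_mean hR hg).trans h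
  rw [← ofReal_norm, ← ENNReal.ofReal_pow (norm_nonneg _), ← ENNReal.ofReal_pow hb,
    ← ENNReal.ofReal_mul (by positivity), ENNReal.ofReal_le_ofReal_iff (by positivity)] at h1
  -- The area inequality gives the factor `2` on the right; it is rounded up to `4` to avoid `√2` in
  -- the final constant.
  have h2 : (‖g c‖ * R) ^ 2 ≤ (2 * b) ^ 2 := by nlinarith [sq_nonneg b]
  have h3 := abs_le_of_sq_le_sq' h2 (by positivity)
  rw [div_mul_eq_mul_div, le_div_iff₀ hR]
  exact h3.2

theorem norm_holoRep_le {D : Set ℂ} (hD : IsOpen D) {z : ℂ} (hz : z ∈ D) :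
    ∃ C : ℝ, ∀ f ∈ bergmanSpace D, ‖holoRep D f z‖ ≤ C * ‖f‖ := by
  obtain ⟨R, hR, hb⟩ := Metric.isOpen_iff.1 hD z hz
  refine ⟨2 / R, fun f hf => ?_⟩
  obtain ⟨h1, h2⟩ := holoRep_spec hD hf
  refine sq_norm_holomorphic_le hR (h1.mono hb) (norm_nonneg _) ?_
  rw [ofReal_norm, enorm_Lp_two_sq]
  refine (lintegral_mono_set hb).trans (le_of_eq (lintegral_congr_ae ?_))
  filter_upwards [h2] with w hw
  rw [hw]

/-- Riesz representation of the evaluation. Linearity uses uniqueness of the holomorphic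
representative, and boundedness is the sub-mean value estimate. -/
theorem exists_evalVec {D : Set ℂ} (hD : IsOpen D) (K : Submodule ℂ (L2 D)) [CompleteSpace K]
    (hK : K ≤ bergmanSpace D) {z : ℂ} (hz : z ∈ D) :
    ∃ k ∈ K, ∀ f ∈ K, inner ℂ k f = holoRep D f z := by
  obtain ⟨C, hC⟩ := norm_holoRep_le hD hz
  let l : K →ₗ[ℂ] ℂ :=
    { toFun := fun f => holoRep D f z
      map_add' := by
        intro f g
        obtain ⟨f1, f2⟩ := holoRep_spec hD (hK f.2)
        obtain ⟨g1, g2⟩ := holoRep_spec hD (hK g.2)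
        exact holoRep_eq hD (f1.add g1) ((Lp.coeFn_add f.1 g.1).trans (f2.add g2)) hz
      map_smul' := by
        intro c f
        obtain ⟨f1, f2⟩ := holoRep_spec hD (hK f.2)
        exact holoRep_eq hD (f1.const_smul c) ((Lp.coeFn_smul c f.1).trans (f2.const_smul c)) hz }
  let L : K →L[ℂ] ℂ := l.mkContinuous C fun f => hC f (hK f.2)
  refine ⟨(InnerProductSpace.toDual ℂ K).symm L, Submodule.coe_mem _, fun f hf => ?_⟩
  have := InnerProductSpace.toDual_symm_apply (𝕜 := ℂ) (x := (⟨f, hf⟩ : K)) (y := L)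
  rw [Submodule.coe_inner] at this
  exact this

theorem evalVec_spec {D : Set ℂ} (hD : IsOpen D) (K : Submodule ℂ (L2 D)) [CompleteSpace K]
    (hK : K ≤ bergmanSpace D) {z : ℂ} (hz : z ∈ D) :
    evalVec K z ∈ K ∧ ∀ f ∈ K, inner ℂ (evalVec K z) f = holoRep D f z := by
  have h := exists_evalVec hD K hK hz
  simp only [evalVec, dif_pos h]
  exact h.choose_spec

theorem evalVec_eq {D : Set ℂ} (hD : IsOpen D) (K : Submodule ℂ (L2 D)) [CompleteSpace K]
    (hK : K ≤ bergmanSpace D) {z : ℂ} (hz : z ∈ D) {k : L2 D} (hk : k ∈ K) (h : ∀ f ∈ K, inner ℂ k f = holoRep D f z) :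
    evalVec K z = k := by
  obtain ⟨h1, h2⟩ := evalVec_spec hD K hK hz
  rw [← sub_eq_zero, ← inner_self_eq_zero (𝕜 := ℂ), inner_sub_left, h2 _ (sub_mem h1 hk),
    h _ (sub_mem h1 hk), sub_self]

theorem inner_evalVec {D : Set ℂ} (hD : IsOpen D) (K : Submodule ℂ (L2 D)) [CompleteSpace K]
    (hK : K ≤ bergmanSpace D) {z : ℂ} (hz : z ∈ D) (f : L2 D) :
    inner ℂ (evalVec K z) f = holoRep D (K.starProjection f) z := by
  obtain ⟨h1, h2⟩ := evalVec_spec hD K hK hz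
  rw [← h2 _ (Submodule.starProjection_apply_mem K f), ← Submodule.inner_starProjection_left_eq_right,
    Submodule.starProjection_eq_self_iff.2 h1]

theorem ae_evalVec_eq {D : Set ℂ} (hD : IsOpen D) (K : Submodule ℂ (L2 D)) [CompleteSpace K]
    (hK : K ≤ bergmanSpace D) {z : ℂ} (hz : z ∈ D) :
    ∀ᵐ w ∂(volume.restrict D), evalVec K z w = starRingEnd ℂ (reproKernel K z w) := by
  filter_upwards [(holoRep_spec hD (hK (evalVec_spec hD K hK hz).1)).2] with w hw
  simp [reproKernel, hw]

theorem memLp_reproKernel {D : Set ℂ} (hD : IsOpen D) (K : Submodule ℂ (L2 D)) [CompleteSpace K]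
    (hK : K ≤ bergmanSpace D) {z : ℂ} (hz : z ∈ D) : MemLp (reproKernel K z) 2 (volume.restrict D) := by
  refine (Lp.memLp (evalVec K z)).star.ae_eq ?_
  filter_upwards [ae_evalVec_eq hD K hK hz] with w hw
  simp [hw]

theorem integral_reproKernel {D : Set ℂ} (hD : IsOpen D) (K : Submodule ℂ (L2 D)) [CompleteSpace K]
    (hK : K ≤ bergmanSpace D) {z : ℂ} (hz : z ∈ D) (f : L2 D) :
    ∫ w in D, reproKernel K z w * f w = holoRep D (K.starProjection f) z := by
  rw [← inner_evalVec hD K hK hz, L2.inner_def]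
  refine integral_congr_ae ?_
  filter_upwards [ae_evalVec_eq hD K hK hz] with w hw
  simp [hw, mul_comm]

/-! ### Lattice translations and the decomposition of the periodic domain into cells. -/

@[simp] theorem lat_re (m : ℤ × ℤ) : (lat m).re = m.1 := rfl
@[simp] theorem lat_im (m : ℤ × ℤ) : (lat m).im = m.2 := rfl
@[simp] theorem lat_zero : lat 0 = 0 := by apply Complex.ext <;> simp
theorem lat_add (m n : ℤ × ℤ) : lat (m + n) = lat m + lat n := by apply Complex.ext <;> simp
theorem lat_neg (m : ℤ × ℤ) : lat (-m) = -lat m := by apply Complex.ext <;> simp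
theorem lat_sub (m n : ℤ × ℤ) : lat (m - n) = lat m - lat n := by apply Complex.ext <;> simp

theorem tr_add_lat_intPart (z : ℂ) : tr z + lat (intPart z) = z := sub_add_cancel _ _

theorem intPart_add_lat (z : ℂ) (m : ℤ × ℤ) : intPart (z + lat m) = intPart z + m := by
  simp [intPart, Prod.ext_iff]

theorem tr_add_lat (z : ℂ) (m : ℤ × ℤ) : tr (z + lat m) = tr z := by
  rw [tr, intPart_add_lat, lat_add, tr]; ring

theorem intPart_eq_zero {z : ℂ} (hz : z ∈ unitSquare) : intPart z = 0 := by
  have h1 : ⌊z.re⌋ = 0 := Int.floor_eq_zero_iff.2 ⟨hz.1.1.le, hz.1.2⟩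
  have h2 : ⌊z.im⌋ = 0 := Int.floor_eq_zero_iff.2 ⟨hz.2.1.le, hz.2.2⟩
  simp [intPart, h1, h2]

theorem tr_eq_self {z : ℂ} (hz : z ∈ unitSquare) : tr z = z := by
  simp [tr, intPart_eq_zero hz]

theorem intPart_add_lat_of_mem {z : ℂ} (hz : z ∈ unitSquare) (m : ℤ × ℤ) :
    intPart (z + lat m) = m := by
  rw [intPart_add_lat, intPart_eq_zero hz, zero_add]

theorem tr_re_mem (z : ℂ) : (tr z).re ∈ Ico (0 : ℝ) 1 :=
  ⟨Int.fract_nonneg z.re, Int.fract_lt_one z.re⟩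

theorem tr_im_mem (z : ℂ) : (tr z).im ∈ Ico (0 : ℝ) 1 :=
  ⟨Int.fract_nonneg z.im, Int.fract_lt_one z.im⟩

theorem mem_cellTranslate {A : Set ℂ} {m : ℤ × ℤ} {z : ℂ} :
    z ∈ cellTranslate A m ↔ z - lat m ∈ A := by
  constructor
  · rintro ⟨w, hw, rfl⟩; simpa using hw
  · intro h; exact ⟨_, h, by simp⟩

theorem closure_cellTranslate (A : Set ℂ) (m : ℤ × ℤ) :
    closure (cellTranslate A m) = cellTranslate (closure A) m :=
  ((Homeomorph.addRight (lat m)).image_closure A).symm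

theorem add_lat_mem_iUnion_closure {ϖ : Set ℂ} {z : ℂ} (k : ℤ × ℤ) :
    z + lat k ∈ (⋃ m : ℤ × ℤ, closure (cellTranslate ϖ m)) ↔
      z ∈ (⋃ m : ℤ × ℤ, closure (cellTranslate ϖ m)) := by
  simp only [mem_iUnion, closure_cellTranslate, mem_cellTranslate]
  constructor
  · rintro ⟨m, h⟩; exact ⟨m - k, by rw [lat_sub]; convert h using 1; ring⟩
  · rintro ⟨m, h⟩; exact ⟨m + k, by rw [lat_add]; convert h using 1; ring⟩

theorem add_lat_mem {ϖ : Set ℂ} {z : ℂ} (k : ℤ × ℤ) :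
    z + lat k ∈ periodicDomain ϖ ↔ z ∈ periodicDomain ϖ := by
  have h := (Homeomorph.addRight (lat k)).preimage_interior (⋃ m : ℤ × ℤ, closure (cellTranslate ϖ m))
  have h2 : (Homeomorph.addRight (lat k)) ⁻¹' (⋃ m : ℤ × ℤ, closure (cellTranslate ϖ m)) =
      ⋃ m : ℤ × ℤ, closure (cellTranslate ϖ m) := by
    ext z; exact add_lat_mem_iUnion_closure k
  rw [h2] at h
  simpa [periodicDomain] using Set.ext_iff.1 h z

theorem sub_lat_mem {ϖ : Set ℂ} {z : ℂ} (k : ℤ × ℤ) :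
    z - lat k ∈ periodicDomain ϖ ↔ z ∈ periodicDomain ϖ := by
  rw [sub_eq_add_neg, ← lat_neg, add_lat_mem]

theorem tr_mem {ϖ : Set ℂ} {z : ℂ} : tr z ∈ periodicDomain ϖ ↔ z ∈ periodicDomain ϖ :=
  sub_lat_mem _

theorem unitSquare_eq : unitSquare = Ioo (0 : ℝ) 1 ×ℂ Ioo (0 : ℝ) 1 := rfl

theorem isOpen_unitSquare : IsOpen unitSquare := isOpen_Ioo.reProdIm isOpen_Ioo

theorem mem_closure_unitSquare {z : ℂ} :
    z ∈ closure unitSquare ↔ z.re ∈ Icc (0 : ℝ) 1 ∧ z.im ∈ Icc (0 : ℝ) 1 := by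
  rw [unitSquare_eq, Complex.closure_reProdIm, closure_Ioo zero_ne_one, Complex.mem_reProdIm]

theorem eq_zero_of_sub_lat_mem {z : ℂ} {m : ℤ × ℤ} (hz : z ∈ unitSquare)
    (h : z - lat m ∈ closure unitSquare) : m = 0 := by
  have h2 := mem_closure_unitSquare.1 h
  obtain ⟨⟨a1, a2⟩, ⟨b1, b2⟩⟩ := hz
  simp only [Complex.sub_re, lat_re, Complex.sub_im, lat_im, mem_Icc] at h2
  obtain ⟨⟨c1, c2⟩, ⟨d1, d2⟩⟩ := h2
  have e1 : m.1 = 0 := by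
    have : (m.1 : ℝ) < 1 := by linarith
    have : (-1 : ℝ) < m.1 := by linarith
    have h3 : m.1 < 1 := by exact_mod_cast ‹(m.1 : ℝ) < 1›
    have h4 : -1 < m.1 := by exact_mod_cast this
    omega
  have e2 : m.2 = 0 := by
    have : (m.2 : ℝ) < 1 := by linarith
    have : (-1 : ℝ) < m.2 := by linarith
    have h3 : m.2 < 1 := by exact_mod_cast ‹(m.2 : ℝ) < 1›
    have h4 : -1 < m.2 := by exact_mod_cast this
    omega
  exact Prod.ext e1 e2

namespace IsPeriodicCell

variable {ϖ : Set ℂ}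

theorem isOpen_cellTranslate (h : IsPeriodicCell ϖ) (m : ℤ × ℤ) : IsOpen (cellTranslate ϖ m) :=
  (Homeomorph.addRight (lat m)).isOpenMap _ h.isOpen

theorem cellTranslate_subset (h : IsPeriodicCell ϖ) (m : ℤ × ℤ) :
    cellTranslate ϖ m ⊆ periodicDomain ϖ :=
  interior_maximal (subset_closure.trans (subset_iUnion (fun m => closure (cellTranslate ϖ m)) m)) (h.isOpen_cellTranslate m)

theorem subset_periodicDomain (h : IsPeriodicCell ϖ) : ϖ ⊆ periodicDomain ϖ := by
  intro z hz
  exact h.cellTranslate_subset 0 (mem_cellTranslate.2 (by simpa using hz))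

theorem add_lat_mem (h : IsPeriodicCell ϖ) {z : ℂ} (hz : z ∈ ϖ) (m : ℤ × ℤ) :
    z + lat m ∈ periodicDomain ϖ := (FloquetBergman.add_lat_mem m).2 (h.subset_periodicDomain hz)

/-- Only the cell with `m = 0` has a closure reaching the open square; on its boundary the
hypothesis `∂Q ⊂ ∂ϖ` applies. This places the whole seam inside the set where functions of
`A²_{η,ext}(ϖ)` are extended. -/
theorem mem_closure_of_mem (h : IsPeriodicCell ϖ) {z : ℂ} (hz : z ∈ periodicDomain ϖ)
    (hQ : z ∈ closure unitSquare) : z ∈ closure ϖ := by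
  by_cases hQ' : z ∈ unitSquare
  · have := interior_subset hz
    simp only [mem_iUnion, closure_cellTranslate, mem_cellTranslate] at this
    obtain ⟨m, hm⟩ := this
    have h2 := closure_mono h.subset_unitSquare hm
    have e : m = 0 := eq_zero_of_sub_lat_mem hQ' h2
    simpa [e] using hm
  · refine frontier_subset_closure (h.frontier_subset ⟨hQ, ?_⟩)
    rwa [isOpen_unitSquare.interior_eq]

theorem tr_eq (h : IsPeriodicCell ϖ) {z : ℂ} {m : ℤ × ℤ} (hz : z ∈ cellTranslate ϖ m) :
    intPart z = m ∧ tr z = z - lat m := by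
  rw [mem_cellTranslate] at hz
  have h1 : intPart z = m := by
    have := intPart_add_lat_of_mem (h.subset_unitSquare hz) m
    simpa using this
  exact ⟨h1, by rw [tr, h1]⟩

theorem pairwise_disjoint (h : IsPeriodicCell ϖ) :
    Pairwise (Function.onFun Disjoint (cellTranslate ϖ)) := by
  intro m n hmn
  refine Set.disjoint_left.2 fun z hm hn => hmn ?_
  rw [← (h.tr_eq hm).1, ← (h.tr_eq hn).1]

theorem ae_mem_cellTranslate (hnull : volume (periodicDomain ϖ \ ⋃ m, cellTranslate ϖ m) = 0) :
    ∀ᵐ z ∂(volume.restrict (periodicDomain ϖ)), ∃ m, z ∈ cellTranslate ϖ m := by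
  rw [ae_restrict_iff' (isOpen_periodicDomain ϖ).measurableSet, ae_iff]
  convert hnull using 2
  ext z; simp

theorem ae_tr_mem (h : IsPeriodicCell ϖ)
    (hnull : volume (periodicDomain ϖ \ ⋃ m, cellTranslate ϖ m) = 0) :
    ∀ᵐ z ∂(volume.restrict (periodicDomain ϖ)), tr z ∈ ϖ := by
  filter_upwards [ae_mem_cellTranslate hnull] with z ⟨m, hm⟩
  rw [(h.tr_eq hm).2]
  exact mem_cellTranslate.1 hm

theorem restrict_periodicDomain (h : IsPeriodicCell ϖ)
    (hnull : volume (periodicDomain ϖ \ ⋃ m, cellTranslate ϖ m) = 0) :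
    volume.restrict (periodicDomain ϖ) = volume.restrict (⋃ m, cellTranslate ϖ m) :=
  (Measure.restrict_congr_set (ae_eq_set.2 ⟨by
    rw [sdiff_eq_empty.2 (iUnion_subset h.cellTranslate_subset)]; exact measure_empty, hnull⟩)).symm

theorem _root_.FloquetBergman.lintegral_cellTranslate (ϖ : Set ℂ) (m : ℤ × ℤ) (f : ℂ → ℝ≥0∞) :
    ∫⁻ z in cellTranslate ϖ m, f z = ∫⁻ z in ϖ, f (z + lat m) := by
  have h1 := (measurePreserving_add_right (volume : Measure ℂ) (lat m)).setLIntegral_comp_preimage_emb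
    (Homeomorph.addRight (lat m)).measurableEmbedding f (cellTranslate ϖ m)
  rw [← h1]
  congr 2
  ext z; simp [mem_cellTranslate]

theorem lintegral_periodicDomain (h : IsPeriodicCell ϖ)
    (hnull : volume (periodicDomain ϖ \ ⋃ m, cellTranslate ϖ m) = 0) (f : ℂ → ℝ≥0∞) :
    ∫⁻ z in periodicDomain ϖ, f z = ∑' m : ℤ × ℤ, ∫⁻ z in ϖ, f (z + lat m) := by
  rw [h.restrict_periodicDomain hnull, lintegral_iUnion
    (fun m => (h.isOpen_cellTranslate m).measurableSet) h.pairwise_disjoint]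
  exact tsum_congr fun m => lintegral_cellTranslate ϖ m f

/-- A property holds almost everywhere in the periodic domain iff it does in each cell. -/
theorem ae_periodicDomain_iff (h : IsPeriodicCell ϖ)
    (hnull : volume (periodicDomain ϖ \ ⋃ m, cellTranslate ϖ m) = 0) {p : ℂ → Prop} :
    (∀ᵐ z ∂(volume.restrict (periodicDomain ϖ)), p z) ↔
      ∀ m, ∀ᵐ z ∂(volume.restrict ϖ), p (z + lat m) := by
  rw [h.restrict_periodicDomain hnull, ae_restrict_iUnion_iff]
  refine forall_congr' fun m => ?_
  have h1 := (measurePreserving_add_right (volume : Measure ℂ) (lat m)).restrict_preimage_emb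
    (Homeomorph.addRight (lat m)).measurableEmbedding (cellTranslate ϖ m)
  have h2 : (fun x => x + lat m) ⁻¹' cellTranslate ϖ m = ϖ := by
    ext z; simp [mem_cellTranslate]
  rw [h2] at h1
  rw [← h1.map_eq]
  exact (Homeomorph.addRight (lat m)).measurableEmbedding.ae_map_iff

end IsPeriodicCell

/-! ### The holomorphic partition of unity given by condition `(𝒜)`. -/

theorem summable_one_add_norm_rpow {b : ℝ} (hb : 2 < b) :
    Summable fun n : ℤ × ℤ => (1 + ‖n‖) ^ (-b) := by
  have h := (finTwoArrowEquiv ℤ).symm.summable_iff.2 (EisensteinSeries.summable_one_div_norm_rpow hb)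
  refine h.of_norm_bounded_eventually ?_
  -- The comparison with `‖n‖ ^ (-b)` fails at the origin, where that power takes the value `0`.
  have h0 : ∀ᶠ n : ℤ × ℤ in cofinite, n ≠ 0 := by simp
  filter_upwards [h0] with n hn
  have h1 : ‖(finTwoArrowEquiv ℤ).symm n‖ = ‖n‖ := by
    apply le_antisymm
    · refine (pi_norm_le_iff_of_nonneg (norm_nonneg _)).2 fun i => ?_
      fin_cases i
      · exact norm_fst_le n
      · exact norm_snd_le n
    · refine norm_prod_le_iff.2 ⟨norm_le_pi_norm ((finTwoArrowEquiv ℤ).symm n) 0,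
        norm_le_pi_norm ((finTwoArrowEquiv ℤ).symm n) 1⟩
  have h2 : 0 < ‖n‖ := norm_pos_iff.2 hn
  rw [Function.comp_apply, h1, Real.norm_of_nonneg (by positivity)]
  exact Real.rpow_le_rpow_of_nonpos h2 (by linarith) (by linarith)

theorem one_add_norm_intPart_le (z : ℂ) : 1 + ‖intPart z‖ ≤ 3 * (1 + ‖z‖) := by
  have key : ∀ x : ℝ, |x| ≤ ‖z‖ → ‖(⌊x⌋ : ℤ)‖ ≤ 1 + ‖z‖ := by
    intro x hx
    rw [Int.norm_eq_abs, abs_le]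
    have := abs_le.1 hx
    constructor <;> linarith [Int.floor_le x, Int.lt_floor_add_one x]
  have : ‖intPart z‖ ≤ 1 + ‖z‖ :=
    norm_prod_le_iff.2 ⟨key _ (Complex.abs_re_le_norm z), key _ (Complex.abs_im_le_norm z)⟩
  linarith [norm_nonneg z]

theorem ae_of_codiscrete {p : ℂ → Prop} (h : ∀ᶠ z in codiscreteWithin (univ : Set ℂ), p z) :
    ∀ᵐ z : ℂ, p z := by
  have := ae_restrict_le_codiscreteWithin (μ := (volume : Measure ℂ)) MeasurableSet.univ h
  rwa [Measure.restrict_univ] at this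

theorem ae_forall_sub_lat {p : ℂ → Prop} (h : ∀ᵐ z : ℂ, p z) :
    ∀ᵐ z : ℂ, ∀ m, p (z - lat m) := by
  rw [ae_all_iff]
  intro m
  exact (measurePreserving_sub_right volume (lat m)).quasiMeasurePreserving.ae h

/-- A meromorphic function in normal form that is bounded almost everywhere on an open set is
holomorphic there. -/
theorem analyticAt_of_ae_bounded {Ψ : ℂ → ℂ} {U : Set ℂ} (hU : IsOpen U) {B : ℝ}
    (hB : ∀ᵐ z ∂(volume.restrict U), ‖Ψ z‖ ≤ B) {p : ℂ} (hp : p ∈ U) (hΨ : MeromorphicNFAt Ψ p) :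
    AnalyticAt ℂ Ψ p := by
  rw [← hΨ.meromorphicOrderAt_nonneg_iff_analyticAt]
  by_contra! hneg
  -- At a pole `‖Ψ‖` would exceed `B` on a punctured neighbourhood, which meets `U` in a set of
  -- positive measure.
  have h1 := (tendsto_cobounded_iff_meromorphicOrderAt_neg hΨ.meromorphicAt).2 hneg
  have h2 : ∀ᶠ z in 𝓝[≠] p, B < ‖Ψ z‖ :=
    (tendsto_norm_cobounded_atTop.comp h1).eventually_gt_atTop B
  obtain ⟨u, hu, hpu, hsub⟩ := mem_nhdsWithin.1 h2
  have hO : IsOpen (u ∩ U ∩ {p}ᶜ) := (hu.inter hU).inter isOpen_compl_singleton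
  have hne : (u ∩ U ∩ {p}ᶜ).Nonempty := by
    have : u ∩ U ∩ {p}ᶜ ∈ 𝓝[≠] p :=
      inter_mem (mem_nhdsWithin_of_mem_nhds ((hu.inter hU).mem_nhds ⟨hpu, hp⟩)) self_mem_nhdsWithin
    exact nonempty_of_mem this
  refine (hO.measure_pos volume hne).ne' ?_
  rw [ae_restrict_iff' hU.measurableSet, ae_iff] at hB
  refine measure_mono_null ?_ hB
  rintro z ⟨⟨h3, h4⟩, h5⟩
  have := hsub ⟨h3, h5⟩
  simp only [mem_ofPred_eq, Classical.not_imp, not_le]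
  exact ⟨h4, this⟩

/-- An elliptic function without zeros in the closure of the periodic domain is bounded from below
there. -/
theorem exists_norm_inv_le {ϖ : Set ℂ} {Φ : ℂ → ℂ} (hΦ : MeromorphicNFOn Φ univ)
    (hper : ∀ z m, Φ (z + lat m) = Φ z)
    (h0 : ∀ z ∈ closure (periodicDomain ϖ), meromorphicOrderAt Φ z ≤ 0) :
    ∃ M : ℝ, 0 ≤ M ∧ ∀ z ∈ periodicDomain ϖ, ‖(Φ z)⁻¹‖ ≤ M := by
  -- Without zeros of `Φ` the inverse has nonnegative order, so its normal form is analytic.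
  -- Periodicity reduces the bound to a compact part of one closed square.
  have hc : ContinuousOn Φ⁻¹ (closure (periodicDomain ϖ) ∩ closure unitSquare) := by
    intro z hz
    have h1 : MeromorphicNFAt Φ⁻¹ z := (hΦ (mem_univ z)).inv
    have h2 : 0 ≤ meromorphicOrderAt Φ⁻¹ z := by
      rw [meromorphicOrderAt_inv]
      have := h0 z hz.1
      revert this
      cases meromorphicOrderAt Φ z with
      | top => simp
      | coe n =>
        intro h
        have h3 : n ≤ 0 := by exact_mod_cast h
        have h4 : 0 ≤ -n := by omega
        exact_mod_cast h4
    exact (h1.meromorphicOrderAt_nonneg_iff_analyticAt.1 h2).continuousAt.continuousWithinAt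
  have hK : IsCompact (closure (periodicDomain ϖ) ∩ closure unitSquare) := by
    refine IsCompact.inter_left ?_ isClosed_closure
    rw [unitSquare_eq, Complex.closure_reProdIm, closure_Ioo zero_ne_one]
    exact isCompact_Icc.reProdIm isCompact_Icc
  obtain ⟨M, hM⟩ := hK.exists_bound_of_continuousOn hc
  refine ⟨max M 0, le_max_right _ _, fun z hz => ?_⟩
  have h1 : Φ z = Φ (tr z) := by rw [← hper (tr z) (intPart z), tr_add_lat_intPart]
  rw [h1]
  refine (hM (tr z) ⟨subset_closure (tr_mem.2 hz), mem_closure_unitSquare.2 ?_⟩).trans (le_max_left _ _)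
  exact ⟨Ico_subset_Icc_self (tr_re_mem z), Ico_subset_Icc_self (tr_im_mem z)⟩

/-- Condition `(𝒜)` provides a holomorphic partition of unity by the translates of a decaying
function. -/
theorem ConditionA.exists_partition {ϖ : Set ℂ} (hϖ : IsPeriodicCell ϖ) (hA : ConditionA ϖ)
    (hnull : volume (periodicDomain ϖ \ ⋃ m, cellTranslate ϖ m) = 0) :
    ∃ (Ψ : ℂ → ℂ) (a : ℤ × ℤ → ℝ), DifferentiableOn ℂ Ψ (periodicDomain ϖ) ∧ Summable a ∧
      (∀ m, 0 ≤ a m) ∧ (∀ᵐ z ∂(volume.restrict (periodicDomain ϖ)), ‖Ψ z‖ ≤ a (intPart z)) ∧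
      ∀ᵐ z ∂(volume.restrict (periodicDomain ϖ)), HasSum (fun m => Ψ (z - lat m)) 1 := by
  obtain ⟨Φ, φ, hΦ, hp1, hpI, hΦ0, hφ, hfin, hQ, hsum, b, d, hb, hdec⟩ := hA
  have hper : ∀ z m, Φ (z + lat m) = Φ z := by
    intro z m
    have h1 : Function.Periodic Φ 1 := hp1
    have h2 : Function.Periodic Φ Complex.I := hpI
    have h3 := (h1.int_mul m.1).add_period (h2.int_mul m.2) z
    rw [← h3]
    congr 2
    apply Complex.ext <;> simp
  have hpers : ∀ z m, Φ (z - lat m) = Φ z := fun z m => by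
    rw [← hper (z - lat m) m, sub_add_cancel]
  obtain ⟨M, hM0, hM⟩ := exists_norm_inv_le hΦ hper hΦ0
  set a₀ : ℤ × ℤ → ℝ := fun n => |d| * 3 ^ b * (1 + ‖n‖) ^ (-b) with ha₀
  have ha₀s : Summable a₀ := (summable_one_add_norm_rpow hb).mul_left _
  have ha₀n : ∀ n, 0 ≤ a₀ n := fun n => by positivity
  have hdec' : ∀ z ∈ periodicDomain ϖ, z ∉ closure unitSquare → ‖φ z‖ ≤ a₀ (intPart z) := by
    intro z hz hz'
    have h1 := (hdec z ⟨hz, hz'⟩).trans (le_abs_self d)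
    have h2 : 0 < 1 + ‖intPart z‖ := by positivity
    have h3 : (1 + ‖intPart z‖) ^ b ≤ 3 ^ b * (1 + ‖z‖) ^ b := by
      rw [← Real.mul_rpow (by norm_num) (by positivity)]
      exact Real.rpow_le_rpow h2.le (one_add_norm_intPart_le z) (by linarith)
    rw [ha₀]
    simp only [Real.rpow_neg h2.le]
    rw [← div_eq_mul_inv, le_div_iff₀ (by positivity)]
    calc ‖φ z‖ * (1 + ‖intPart z‖) ^ b ≤ ‖φ z‖ * (3 ^ b * (1 + ‖z‖) ^ b) := by gcongr
      _ = 3 ^ b * ((1 + ‖z‖) ^ b * ‖φ z‖) := by ring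
      _ ≤ 3 ^ b * |d| := by gcongr
      _ = _ := by ring
  have hmero : MeromorphicOn (φ * Φ⁻¹) univ := hφ.meromorphicOn.mul hΦ.meromorphicOn.inv
  -- The normal form fills in removable singularities of the quotient; it agrees with the pointwise
  -- quotient almost everywhere.
  set Ψ : ℂ → ℂ := toMeromorphicNFOn (φ * Φ⁻¹) univ with hΨdef
  have hpole : ∀ᵐ z : ℂ, ∀ m, z - lat m ∉ poles φ :=
    ae_forall_sub_lat (p := fun z => z ∉ poles φ)
      (measure_eq_zero_iff_ae_notMem.1 (hfin.countable.measure_zero volume))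
  have hΨ : ∀ᵐ z : ℂ, ∀ m, Ψ (z - lat m) = φ (z - lat m) * (Φ z)⁻¹ := by
    have h1 : ∀ᵐ z : ℂ, Ψ z = φ z * (Φ z)⁻¹ :=
      ae_of_codiscrete (toMeromorphicNFOn_eqOn_codiscrete hmero).symm
    filter_upwards [ae_forall_sub_lat h1] with z hz m
    rw [hz m, hpers]
  have han : ∀ᵐ z : ℂ, AnalyticAt ℂ Φ z :=
    ae_of_codiscrete (MeromorphicOn.eventually_codiscreteWithin_analyticAt Φ hΦ.meromorphicOn)
  have hne : ∀ᵐ z ∂(volume.restrict (periodicDomain ϖ)), Φ z ≠ 0 := by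
    filter_upwards [ae_restrict_of_ae han, ae_restrict_mem (isOpen_periodicDomain ϖ).measurableSet]
      with z h1 h2
    have h3 := le_antisymm (hΦ0 z (subset_closure h2)) h1.meromorphicOrderAt_nonneg
    exact ((hΦ (mem_univ z)).meromorphicOrderAt_eq_zero_iff).1 h3
  -- Off the cell `n = 0` the decay of `φ` suffices. On that cell `φ` may have poles, and `φ / Φ = 1
  -- - ∑_{m ≠ 0} φ(· - m) / Φ` is bounded by `1 + (∑ a₀) M`.
  set a : ℤ × ℤ → ℝ := fun n => a₀ n * M + if n = 0 then 1 + (∑' m, a₀ m) * M else 0 with ha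
  have hS : 0 ≤ ∑' m, a₀ m := tsum_nonneg ha₀n
  have has : Summable a :=
    (ha₀s.mul_right M).add (hasSum_ite_eq (0 : ℤ × ℤ) (1 + (∑' m, a₀ m) * M)).summable
  have han0 : ∀ m, 0 ≤ a m := by
    intro m
    have := ha₀n m
    simp only [ha]
    split_ifs <;> positivity
  have hbd : ∀ᵐ z ∂(volume.restrict (periodicDomain ϖ)), ‖Ψ z‖ ≤ a (intPart z) := by
    filter_upwards [ae_restrict_of_ae hpole, ae_restrict_of_ae hΨ, hne, hϖ.ae_tr_mem hnull,
      ae_restrict_mem (isOpen_periodicDomain ϖ).measurableSet] with z h1 h2 h3 h4 h5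
    have h6 := h2 0
    rw [lat_zero, sub_zero] at h6
    rw [h6, norm_mul]
    by_cases hn : intPart z = 0
    · have hz : tr z = z := by simp [tr, hn]
      rw [hz] at h4
      have hzQ := hϖ.subset_unitSquare h4
      have h7 := (hsum z h5 h1).sub (hasSum_ite_eq (0 : ℤ × ℤ) (φ z))
      have h8 : ‖Φ z - φ z‖ ≤ ∑' m, a₀ m := by
        refine h7.norm_le_of_bounded ha₀s.hasSum fun m => ?_
        split_ifs with hm
        · simpa [hm] using ha₀n 0
        · rw [sub_zero]
          have h9 : intPart (z - lat m) = -m := by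
            rw [sub_eq_add_neg, ← lat_neg, intPart_add_lat_of_mem hzQ]
          have h10 := hdec' (z - lat m) ((sub_lat_mem m).2 h5)
            fun h => hm (eq_zero_of_sub_lat_mem hzQ h)
          rw [h9] at h10
          simpa [ha₀] using h10
      have h9 : ‖φ z‖ * ‖(Φ z)⁻¹‖ ≤ 1 + (∑' m, a₀ m) * M := by
        have h10 : φ z * (Φ z)⁻¹ = 1 - (Φ z - φ z) * (Φ z)⁻¹ := by field_simp; ring
        rw [← norm_mul, h10]
        refine (norm_sub_le _ _).trans ?_
        rw [norm_one, norm_mul]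
        gcongr
        exact hM z h5
      simp only [ha, hn, if_true]
      nlinarith [mul_nonneg (ha₀n 0) hM0]
    · have h7 : z ∉ closure unitSquare := by
        intro h
        apply hn
        have := eq_zero_of_sub_lat_mem (z := tr z) (m := -intPart z) (hϖ.subset_unitSquare h4)
          (by rw [lat_neg, sub_neg_eq_add, tr_add_lat_intPart]; exact h)
        simpa using this
      simp only [ha, hn, if_false, add_zero]
      exact mul_le_mul (hdec' z h5 h7) (hM z h5) (norm_nonneg _) (ha₀n _)
  refine ⟨Ψ, a, ?_, has, han0, hbd, ?_⟩
  · intro p hp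
    -- The almost everywhere bound excludes poles of `Ψ` in `Ω`, so the poles of `φ` there are
    -- cancelled by those of `Φ`.
    refine (analyticAt_of_ae_bounded (isOpen_periodicDomain ϖ) (B := ∑' m, a m) ?_ hp
      (meromorphicNFOn_toMeromorphicNFOn _ _ (mem_univ p))).differentiableAt.differentiableWithinAt
    filter_upwards [hbd] with z hz
    exact hz.trans (has.le_tsum _ fun m _ => han0 m)
  · filter_upwards [ae_restrict_of_ae hpole, ae_restrict_of_ae hΨ, hne,
      ae_restrict_mem (isOpen_periodicDomain ϖ).measurableSet] with z h1 h2 h3 h5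
    simp only [h2]
    have := (hsum z h5 h1).mul_right (Φ z)⁻¹
    rwa [mul_inv_cancel₀ h3] at this

/-! ### Quasiperiodic extension from the cell to the periodic domain. -/

theorem pairing_add (m n : ℤ × ℤ) (η : ℝ × ℝ) : pairing (m + n) η = pairing m η + pairing n η := by
  simp [pairing]; ring

theorem pairing_neg (m : ℤ × ℤ) (η : ℝ × ℝ) : pairing (-m) η = -pairing m η := by
  simp [pairing]; ring

theorem pairing_sub (m n : ℤ × ℤ) (η : ℝ × ℝ) : pairing (m - n) η = pairing m η - pairing n η := by
  rw [sub_eq_add_neg, pairing_add, pairing_neg, sub_eq_add_neg]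

@[simp] theorem pairing_zero (η : ℝ × ℝ) : pairing 0 η = 0 := by simp [pairing]

/-- If `g(z + c) = e g(z)` on a short segment starting at `w`, then the identity holds near `w`. -/
theorem eventually_eq_of_segment {g : ℂ → ℂ} {V : Set ℂ} (hV : IsOpen V)
    (hg : DifferentiableOn ℂ g V) {w c u e : ℂ} (hw : w ∈ V) (hwc : w + c ∈ V) (hu : u ≠ 0)
    (h : ∀ᶠ t : ℝ in 𝓝[>] 0, g (w + t * u + c) = e * g (w + t * u)) :
    ∀ᶠ z in 𝓝 w, g (z + c) = e * g z := by
  have h1 : AnalyticAt ℂ (fun z => g (z + c)) w := by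
    have h3 : AnalyticAt ℂ g (w + c) := (hg.analyticOnNhd hV) _ hwc
    exact h3.comp_of_eq (by fun_prop) rfl
  have h2 : AnalyticAt ℂ (fun z => e * g z) w := analyticAt_const.mul ((hg.analyticOnNhd hV) _ hw)
  -- Identity theorem: equality at points accumulating at `w` is enough.
  rw [← h1.frequently_eq_iff_eventually_eq h2]
  have ht : Tendsto (fun t : ℝ => w + t * u) (𝓝[>] 0) (𝓝[≠] w) := by
    refine tendsto_nhdsWithin_iff.2 ⟨?_, ?_⟩
    · have hc : Continuous fun t : ℝ => w + t * u := by fun_prop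
      have := hc.tendsto 0
      simp only [Complex.ofReal_zero, zero_mul, add_zero] at this
      exact this.mono_left nhdsWithin_le_nhds
    · filter_upwards [self_mem_nhdsWithin] with t ht
      simp only [mem_compl_iff, mem_singleton_iff, add_eq_left, mul_eq_zero, hu, or_false,
        Complex.ofReal_eq_zero]
      exact (ne_of_gt ht)
  exact ht.frequently h.frequently

section
variable {ϖ : Set ℂ} {η : ℝ × ℝ} {V : Set ℂ} {g : ℂ → ℂ}

/-- The boundary condition holds only on the open side of the square; the identity theorem carries
it to a neighbourhood. The corner `w = 0` is included because the upward segment from it enters the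
open side at once. -/
theorem eventually_add_one (hϖ : IsPeriodicCell ϖ) (hV : IsOpen V)
    (hsub : closure ϖ ∩ periodicDomain ϖ ⊆ V) (hg : DifferentiableOn ℂ g V)
    (hp : ∀ y ∈ Ioo (0 : ℝ) 1, (y * Complex.I : ℂ) ∈ periodicDomain ϖ →
      g (1 + y * Complex.I) = Complex.exp (Complex.I * η.1) * g (y * Complex.I))
    {w : ℂ} (hw : w ∈ periodicDomain ϖ) (hre : w.re = 0) (him : w.im ∈ Ico (0 : ℝ) 1) :
    ∀ᶠ z in 𝓝 w, g (z + 1) = Complex.exp (Complex.I * η.1) * g z := by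
  have hl : lat (1, 0) = 1 := by apply Complex.ext <;> simp
  have hw1 : w + 1 ∈ periodicDomain ϖ := by rw [← hl]; exact (add_lat_mem _).2 hw
  have hm : w ∈ V := hsub ⟨hϖ.mem_closure_of_mem hw
    (mem_closure_unitSquare.2 ⟨by simp [hre], Ico_subset_Icc_self him⟩), hw⟩
  have hm1 : w + 1 ∈ V := hsub ⟨hϖ.mem_closure_of_mem hw1
    (mem_closure_unitSquare.2 ⟨by simp [hre], by simpa using Ico_subset_Icc_self him⟩), hw1⟩
  refine eventually_eq_of_segment hV hg hm hm1 Complex.I_ne_zero ?_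
  have h1 : ∀ᶠ t : ℝ in 𝓝[>] 0, w + t * Complex.I ∈ periodicDomain ϖ := by
    have hc : Continuous fun t : ℝ => w + t * Complex.I := by fun_prop
    refine nhdsWithin_le_nhds (hc.continuousAt.eventually_mem ?_)
    simpa using (isOpen_periodicDomain ϖ).mem_nhds hw
  filter_upwards [h1, self_mem_nhdsWithin,
    nhdsWithin_le_nhds (Iio_mem_nhds (sub_pos.2 him.2))] with t ht1 ht2 ht3
  have e : w + t * Complex.I = ((w.im + t : ℝ) : ℂ) * Complex.I := by
    apply Complex.ext <;> simp [hre]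
  rw [e] at ht1 ⊢
  have ht2' : 0 < t := ht2
  have ht3' : t < 1 - w.im := ht3
  rw [add_comm _ (1 : ℂ)]
  exact hp _ ⟨by linarith [him.1], by linarith⟩ ht1

theorem eventually_add_I (hϖ : IsPeriodicCell ϖ) (hV : IsOpen V)
    (hsub : closure ϖ ∩ periodicDomain ϖ ⊆ V) (hg : DifferentiableOn ℂ g V)
    (hq : ∀ x ∈ Ioo (0 : ℝ) 1, (x : ℂ) ∈ periodicDomain ϖ →
      g (x + Complex.I) = Complex.exp (Complex.I * η.2) * g x)
    {w : ℂ} (hw : w ∈ periodicDomain ϖ) (hre : w.re ∈ Icc (0 : ℝ) 1) (him : w.im = 0) :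
    ∀ᶠ z in 𝓝 w, g (z + Complex.I) = Complex.exp (Complex.I * η.2) * g z := by
  have hl : lat (0, 1) = Complex.I := by apply Complex.ext <;> simp
  have hw1 : w + Complex.I ∈ periodicDomain ϖ := by rw [← hl]; exact (add_lat_mem _).2 hw
  have hm : w ∈ V := hsub ⟨hϖ.mem_closure_of_mem hw
    (mem_closure_unitSquare.2 ⟨hre, by simp [him]⟩), hw⟩
  have hm1 : w + Complex.I ∈ V := hsub ⟨hϖ.mem_closure_of_mem hw1
    (mem_closure_unitSquare.2 ⟨by simpa using hre, by simp [him]⟩), hw1⟩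
  -- At the right corner the segment must run to the left. That corner arises when the shift by `1`
  -- is followed by the shift by `i`.
  obtain ⟨s, hs0, hs⟩ : ∃ s : ℝ, s ≠ 0 ∧ ∀ᶠ t : ℝ in 𝓝[>] 0, w.re + t * s ∈ Ioo (0 : ℝ) 1 := by
    rcases hre.2.lt_or_eq with h | h
    · refine ⟨1, one_ne_zero, ?_⟩
      filter_upwards [self_mem_nhdsWithin, nhdsWithin_le_nhds (Iio_mem_nhds (sub_pos.2 h))]
        with t (ht2 : 0 < t) (ht3 : t < 1 - w.re)
      exact ⟨by linarith [hre.1], by linarith⟩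
    · refine ⟨-1, by norm_num, ?_⟩
      filter_upwards [self_mem_nhdsWithin, nhdsWithin_le_nhds (Iio_mem_nhds one_pos)]
        with t (ht2 : 0 < t) (ht3 : t < 1)
      exact ⟨by linarith, by linarith⟩
  refine eventually_eq_of_segment hV hg hm hm1 (u := (s : ℂ)) (by exact_mod_cast hs0) ?_
  have h1 : ∀ᶠ t : ℝ in 𝓝[>] 0, w + t * (s : ℂ) ∈ periodicDomain ϖ := by
    have hc : Continuous fun t : ℝ => w + t * (s : ℂ) := by fun_prop
    refine nhdsWithin_le_nhds (hc.continuousAt.eventually_mem ?_)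
    simpa using (isOpen_periodicDomain ϖ).mem_nhds hw
  filter_upwards [h1, hs] with t ht1 ht2
  have e : w + t * (s : ℂ) = ((w.re + t * s : ℝ) : ℂ) := by
    apply Complex.ext <;> simp [him]
  rw [e] at ht1 ⊢
  exact hq _ ht2 ht1

end

/-- The extension is `exp(i η·[z]) g(z^tr)`, quasiperiodic by construction. The content is
holomorphy across the seams, where the boundary conditions make `G` coincide with the local
extension `g`. -/
theorem exists_quasiperiodic_extension {ϖ : Set ℂ} (hϖ : IsPeriodicCell ϖ) {η : ℝ × ℝ} {f : L2 ϖ}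
    (hf : f ∈ quasiExt ϖ η) :
    ∃ G : ℂ → ℂ, DifferentiableOn ℂ G (periodicDomain ϖ) ∧ f =ᵐ[volume.restrict ϖ] G ∧
      ∀ z m, G (z + lat m) = Complex.exp (Complex.I * pairing m η) * G z := by
  obtain ⟨-, V, g, hV, hsub, -, hg, hfg, hp, hq⟩ := hf
  set G : ℂ → ℂ := fun z => Complex.exp (Complex.I * pairing (intPart z) η) * g (tr z) with hG
  have hper : ∀ z m, G (z + lat m) = Complex.exp (Complex.I * pairing m η) * G z := by
    intro z m
    simp only [hG, tr_add_lat, intPart_add_lat, pairing_add]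
    rw [← mul_assoc, ← Complex.exp_add]
    push_cast
    ring_nf
  -- It suffices to treat the half-open square; quasiperiodicity moves every other point there.
  have key : ∀ w ∈ periodicDomain ϖ, w.re ∈ Ico (0 : ℝ) 1 → w.im ∈ Ico (0 : ℝ) 1 →
      DifferentiableAt ℂ G w := by
    intro w hw hre him
    have hwV : w ∈ V := hsub ⟨hϖ.mem_closure_of_mem hw (mem_closure_unitSquare.2
      ⟨Ico_subset_Icc_self hre, Ico_subset_Icc_self him⟩), hw⟩
    have hd : DifferentiableAt ℂ g w := hg.differentiableAt (hV.mem_nhds hwV)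
    refine hd.congr_of_eventuallyEq ?_
    have cre : Tendsto Complex.re (𝓝 w) (𝓝 w.re) := Complex.continuous_re.tendsto w
    have cim : Tendsto Complex.im (𝓝 w) (𝓝 w.im) := Complex.continuous_im.tendsto w
    have c1 : Tendsto (fun z : ℂ => z + 1) (𝓝 w) (𝓝 (w + 1)) :=
      (continuous_add_const (1 : ℂ)).tendsto w
    -- Near `w` a coordinate can have integer part `-1` only if that coordinate of `w` vanishes.
    have hfl : ∀ (r : ℂ → ℝ), Tendsto r (𝓝 w) (𝓝 (r w)) → r w ∈ Ico (0 : ℝ) 1 →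
        ∀ᶠ z in 𝓝 w, ⌊r z⌋ = 0 ∨ (r w = 0 ∧ ⌊r z⌋ = -1) := by
      intro r hr h
      rcases h.1.lt_or_eq with h1 | h1
      · filter_upwards [hr.eventually (Ioo_mem_nhds h1 h.2)] with z hz
        exact Or.inl (Int.floor_eq_zero_iff.2 ⟨hz.1.le, hz.2⟩)
      · filter_upwards [hr.eventually (Ioo_mem_nhds (show -1 < r w by linarith [h.1]) h.2)] with z hz
        rcases le_or_gt 0 (r z) with h2 | h2
        · exact Or.inl (Int.floor_eq_zero_iff.2 ⟨h2, hz.2⟩)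
        · refine Or.inr ⟨h1.symm, Int.floor_eq_iff.2 ⟨?_, ?_⟩⟩
          · push_cast; linarith [hz.1]
          · push_cast; linarith
    have e1 : ∀ᶠ z in 𝓝 w, w.re = 0 → g (z + 1) = Complex.exp (Complex.I * η.1) * g z := by
      by_cases h : w.re = 0
      · filter_upwards [eventually_add_one hϖ hV hsub hg hp hw h him] with z hz _ using hz
      · simp [h]
    have e2 : ∀ᶠ z in 𝓝 w, w.im = 0 → g (z + Complex.I) = Complex.exp (Complex.I * η.2) * g z := by
      by_cases h : w.im = 0
      · filter_upwards [eventually_add_I hϖ hV hsub hg hq hw (Ico_subset_Icc_self hre) h]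
          with z hz _ using hz
      · simp [h]
    have e3 : ∀ᶠ z in 𝓝 w, w.re = 0 → w.im = 0 →
        g (z + 1 + Complex.I) = Complex.exp (Complex.I * η.2) * g (z + 1) := by
      by_cases h : w.re = 0
      · by_cases h' : w.im = 0
        · have hl : lat (1, 0) = 1 := by apply Complex.ext <;> simp
          have hw1 : w + 1 ∈ periodicDomain ϖ := by rw [← hl]; exact (add_lat_mem _).2 hw
          filter_upwards [c1.eventually (eventually_add_I hϖ hV hsub hg hq hw1
            (by simp [h]) (by simp [h']))] with z hz _ _ using hz
        · simp [h']
      · simp [h]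
    filter_upwards [hfl _ cre hre, hfl _ cim him, e1, e2, e3] with z a1 a2 b1 b2 b3
    simp only [hG, tr, pairing]
    -- The four cases are the square itself, the cell below, the cell to the left, and the diagonal
    -- cell at the corner, where both multipliers occur.
    rcases a1 with a1 | ⟨h1, a1⟩ <;> rcases a2 with a2 | ⟨h2, a2⟩
    · have : lat (intPart z) = 0 := by apply Complex.ext <;> simp [intPart, a1, a2]
      rw [this]; simp [intPart, a1, a2]
    · have : lat (intPart z) = -Complex.I := by apply Complex.ext <;> simp [intPart, a1, a2]
      rw [this, sub_neg_eq_add, b2 h2, ← mul_assoc, ← Complex.exp_add]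
      simp [intPart, a1, a2]
    · have : lat (intPart z) = -1 := by apply Complex.ext <;> simp [intPart, a1, a2]
      rw [this, sub_neg_eq_add, b1 h1, ← mul_assoc, ← Complex.exp_add]
      simp [intPart, a1, a2]
    · have : lat (intPart z) = -(1 + Complex.I) := by
        apply Complex.ext <;> simp [intPart, a1, a2]
      rw [this, sub_neg_eq_add, ← add_assoc, b3 h1 h2, b1 h1, ← mul_assoc, ← mul_assoc,
        ← Complex.exp_add, ← Complex.exp_add]
      simp only [intPart, a1, a2]
      push_cast
      ring_nf
      simp
  refine ⟨G, fun z hz => ?_, ?_, hper⟩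
  · have h1 := key (tr z) (tr_mem.2 hz) (tr_re_mem z) (tr_im_mem z)
    have h2 : G = fun w => Complex.exp (Complex.I * pairing (intPart z) η) *
        G (w - lat (intPart z)) := by
      funext w
      rw [← hper, sub_add_cancel]
    rw [h2]
    refine DifferentiableAt.differentiableWithinAt ?_
    have h3 : DifferentiableAt ℂ (fun w => G (w - lat (intPart z))) z :=
      DifferentiableAt.comp z (g := G) (f := fun w => w - lat (intPart z)) h1 (by fun_prop)
    exact h3.const_mul _
  · filter_upwards [hfg, ae_restrict_mem hϖ.isOpen.measurableSet] with z hz hz'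
    have := hϖ.subset_unitSquare hz'
    simp [hG, intPart_eq_zero this, tr_eq_self this, hz]

theorem mem_quasiExt {ϖ : Set ℂ} (hϖ : IsPeriodicCell ϖ) {η : ℝ × ℝ} {f : L2 ϖ} {G : ℂ → ℂ}
    (hG : DifferentiableOn ℂ G (periodicDomain ϖ)) (hfG : f =ᵐ[volume.restrict ϖ] G)
    (hper : ∀ z m, G (z + lat m) = Complex.exp (Complex.I * pairing m η) * G z) :
    f ∈ quasiExt ϖ η := by
  refine ⟨mem_bergmanSpace (hG.mono hϖ.subset_periodicDomain) hfG, periodicDomain ϖ, G,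
    isOpen_periodicDomain ϖ, inter_subset_right, subset_rfl, hG, hfG, fun y _ _ => ?_, fun x _ _ => ?_⟩
  · have h := hper (y * Complex.I) (1, 0)
    have hl : lat (1, 0) = 1 := by apply Complex.ext <;> simp
    rw [hl, add_comm] at h
    simpa [pairing] using h
  · have h := hper x (0, 1)
    have hl : lat (0, 1) = Complex.I := by apply Complex.ext <;> simp
    rw [hl] at h
    simpa [pairing] using h

theorem quasiSpace_le_bergmanSpace {ϖ : Set ℂ} (hϖ : IsPeriodicCell ϖ) (η : ℝ × ℝ) :
    quasiSpace ϖ η ≤ bergmanSpace ϖ :=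
  Submodule.topologicalClosure_minimal _ (fun _ hf => hf.1) (isClosed_bergman hϖ.isOpen)

/-! ### Square integrable functions as square summable sequences on the cells. -/

variable {ϖ : Set ℂ}

theorem coeFn_cellPart (hϖ : IsPeriodicCell ϖ) (m : ℤ × ℤ) (f : L2 (periodicDomain ϖ)) :
    cellPart ϖ m f =ᵐ[volume.restrict ϖ] fun z => f (z + lat m) := by
  filter_upwards [(memLp_cellPart ϖ m f).coeFn_toLp, ae_restrict_mem hϖ.isOpen.measurableSet]
    with z h1 h2
  rw [cellPart, h1, indicator_of_mem (hϖ.add_lat_mem h2 m)]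

theorem ae_cell_of_ae (hϖ : IsPeriodicCell ϖ) {p : ℂ → Prop}
    (h : ∀ᵐ z ∂(volume.restrict (periodicDomain ϖ)), p z) (m : ℤ × ℤ) :
    ∀ᵐ z ∂(volume.restrict ϖ), p (z + lat m) := by
  rw [ae_restrict_iff' (isOpen_periodicDomain ϖ).measurableSet] at h
  have h1 := (measurePreserving_add_right (volume : Measure ℂ) (lat m)).quasiMeasurePreserving.ae h
  filter_upwards [ae_restrict_of_ae h1, ae_restrict_mem hϖ.isOpen.measurableSet] with z h2 h3
  exact h2 (hϖ.add_lat_mem h3 m)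

theorem cellPart_eq_of_ae (hϖ : IsPeriodicCell ϖ) (m : ℤ × ℤ) {f : L2 (periodicDomain ϖ)}
    {g : ℂ → ℂ} (h : f =ᵐ[volume.restrict (periodicDomain ϖ)] g) :
    cellPart ϖ m f =ᵐ[volume.restrict ϖ] fun z => g (z + lat m) :=
  (coeFn_cellPart hϖ m f).trans (ae_cell_of_ae hϖ h m)

theorem cellPart_add (hϖ : IsPeriodicCell ϖ) (m : ℤ × ℤ) (f g : L2 (periodicDomain ϖ)) :
    cellPart ϖ m (f + g) = cellPart ϖ m f + cellPart ϖ m g := by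
  apply Lp.ext
  filter_upwards [cellPart_eq_of_ae hϖ m (Lp.coeFn_add f g), coeFn_cellPart hϖ m f,
    coeFn_cellPart hϖ m g, Lp.coeFn_add (cellPart ϖ m f) (cellPart ϖ m g)] with z h1 h2 h3 h4
  rw [h1, h4, Pi.add_apply, Pi.add_apply, h2, h3]

theorem cellPart_smul (hϖ : IsPeriodicCell ϖ) (m : ℤ × ℤ) (c : ℂ) (f : L2 (periodicDomain ϖ)) :
    cellPart ϖ m (c • f) = c • cellPart ϖ m f := by
  apply Lp.ext
  filter_upwards [cellPart_eq_of_ae hϖ m (Lp.coeFn_smul c f), coeFn_cellPart hϖ m f,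
    Lp.coeFn_smul c (cellPart ϖ m f)] with z h1 h2 h4
  rw [h1, h4, Pi.smul_apply, Pi.smul_apply, h2]

theorem tsum_enorm_cellPart (hϖ : IsPeriodicCell ϖ)
    (hnull : volume (periodicDomain ϖ \ ⋃ m, cellTranslate ϖ m) = 0) (f : L2 (periodicDomain ϖ)) :
    ∑' m, ‖cellPart ϖ m f‖ₑ ^ 2 = ‖f‖ₑ ^ 2 := by
  rw [enorm_Lp_two_sq, hϖ.lintegral_periodicDomain hnull]
  refine tsum_congr fun m => ?_
  rw [enorm_Lp_two_sq]
  refine lintegral_congr_ae ?_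
  filter_upwards [coeFn_cellPart hϖ m f] with z hz
  rw [hz]

theorem hasSum_norm_sq_cellPart (hϖ : IsPeriodicCell ϖ)
    (hnull : volume (periodicDomain ϖ \ ⋃ m, cellTranslate ϖ m) = 0) (f : L2 (periodicDomain ϖ)) :
    HasSum (fun m => ‖cellPart ϖ m f‖ ^ 2) (‖f‖ ^ 2) := by
  have h : HasSum (fun m => ‖cellPart ϖ m f‖ₑ ^ 2) (‖f‖ₑ ^ 2) := by
    rw [← tsum_enorm_cellPart hϖ hnull f]
    exact ENNReal.summable.hasSum
  simp only [enorm_eq_nnnorm, ← ENNReal.coe_pow] at h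
  have h2 := NNReal.hasSum_coe.2 (ENNReal.hasSum_coe.1 h)
  simpa using h2

/-- The sequence of the restrictions to the cells. -/
def cellSeq (hϖ : IsPeriodicCell ϖ)
    (hnull : volume (periodicDomain ϖ \ ⋃ m, cellTranslate ϖ m) = 0) :
    L2 (periodicDomain ϖ) →ₗᵢ[ℂ] lp (fun _ : ℤ × ℤ => L2 ϖ) 2 where
  toFun f := ⟨fun m => cellPart ϖ m f, by
    refine memℓp_gen ?_
    simpa using (hasSum_norm_sq_cellPart hϖ hnull f).summable⟩
  map_add' f g := by ext1; funext m; exact cellPart_add hϖ m f g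
  map_smul' c f := by ext1; funext m; exact cellPart_smul hϖ m c f
  norm_map' f := by
    have h := lp.norm_rpow_eq_tsum (p := 2) (by norm_num) (⟨fun m => cellPart ϖ m f, by
      refine memℓp_gen ?_
      simpa using (hasSum_norm_sq_cellPart hϖ hnull f).summable⟩ : lp (fun _ : ℤ × ℤ => L2 ϖ) 2)
    simp only [ENNReal.toReal_ofNat, Real.rpow_ofNat] at h
    rw [(hasSum_norm_sq_cellPart hϖ hnull f).tsum_eq] at h
    exact (pow_left_inj₀ (norm_nonneg _) (norm_nonneg _) two_ne_zero).1 h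

theorem inner_eq_tsum_cellPart (hϖ : IsPeriodicCell ϖ)
    (hnull : volume (periodicDomain ϖ \ ⋃ m, cellTranslate ϖ m) = 0)
    (f g : L2 (periodicDomain ϖ)) :
    inner ℂ f g = ∑' m, inner ℂ (cellPart ϖ m f) (cellPart ϖ m g) := by
  rw [← (cellSeq hϖ hnull).inner_map_map, lp.inner_eq_tsum]
  rfl

/-- A function on the `n`-th cell, extended by zero. -/
theorem exists_cellPart_eq_single (hϖ : IsPeriodicCell ϖ) (n : ℤ × ℤ) (h : L2 ϖ) :
    ∃ e : L2 (periodicDomain ϖ), cellPart ϖ n e = h ∧ ∀ m ≠ n, cellPart ϖ m e = 0 := by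
  have h1 : MemLp (ϖ.indicator h) 2 volume :=
    (memLp_indicator_iff_restrict hϖ.isOpen.measurableSet).2 (Lp.memLp h)
  have h2 : MemLp (fun z => ϖ.indicator h (z - lat n)) 2 (volume.restrict (periodicDomain ϖ)) :=
    (h1.comp_measurePreserving (measurePreserving_sub_right volume (lat n))).restrict _
  refine ⟨h2.toLp, ?_, fun m hm => ?_⟩
  · apply Lp.ext
    filter_upwards [cellPart_eq_of_ae hϖ n h2.coeFn_toLp, ae_restrict_mem hϖ.isOpen.measurableSet]
      with z h3 h4
    rw [h3, add_sub_cancel_right, indicator_of_mem h4]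
  · apply Lp.ext
    filter_upwards [cellPart_eq_of_ae hϖ m h2.coeFn_toLp, ae_restrict_mem hϖ.isOpen.measurableSet,
      Lp.coeFn_zero ℂ 2 (volume.restrict ϖ)] with z h3 h4 h5
    rw [h3, h5, indicator_of_notMem, Pi.zero_apply]
    intro h6
    apply hm
    have h7 := (hϖ.tr_eq (mem_cellTranslate.2 h6)).1
    rw [← h7, intPart_add_lat_of_mem (hϖ.subset_unitSquare h4)]

/-! ### The Floquet transform as an isometry, and its adjoint. -/

theorem integral_exp_int_mul (k : ℤ) :
    ∫ x in Icc (-Real.pi) Real.pi, Complex.exp (Complex.I * (k * x : ℝ)) =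
      if k = 0 then (2 * Real.pi : ℂ) else 0 := by
  rw [integral_Icc_eq_integral_Ioc, ← intervalIntegral.integral_of_le (by linarith [Real.pi_pos])]
  split_ifs with h
  · subst h; simp; ring
  · have hc : Complex.I * k ≠ 0 := mul_ne_zero Complex.I_ne_zero (by exact_mod_cast h)
    have h1 : ∀ x : ℝ, Complex.I * ((k * x : ℝ) : ℂ) = Complex.I * k * x := by
      intro x; push_cast; ring
    simp only [h1]
    rw [integral_exp_mul_complex hc, div_eq_zero_iff]
    left
    rw [sub_eq_zero, Complex.exp_eq_exp_iff_exists_int]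
    exact ⟨k, by push_cast; ring⟩

theorem floquetMeasure_eq : floquetMeasure =
    (volume.restrict (Icc (-Real.pi) Real.pi)).prod (volume.restrict (Icc (-Real.pi) Real.pi)) := by
  rw [floquetMeasure, floquetSquare, Measure.volume_eq_prod, Measure.prod_restrict]

theorem integral_exp_pairing (m : ℤ × ℤ) :
    ∫ η, Complex.exp (Complex.I * pairing m η) ∂floquetMeasure =
      if m = 0 then (4 * Real.pi ^ 2 : ℂ) else 0 := by
  have h : ∀ η : ℝ × ℝ, Complex.exp (Complex.I * pairing m η) =
      Complex.exp (Complex.I * (m.1 * η.1 : ℝ)) * Complex.exp (Complex.I * (m.2 * η.2 : ℝ)) := by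
    intro η
    rw [← Complex.exp_add, pairing]
    push_cast; ring_nf
  simp only [h]
  rw [floquetMeasure_eq, integral_prod_mul (fun x : ℝ => Complex.exp (Complex.I * (m.1 * x : ℝ)))
    (fun x : ℝ => Complex.exp (Complex.I * (m.2 * x : ℝ))), integral_exp_int_mul,
    integral_exp_int_mul]
  by_cases h1 : m.1 = 0 <;> by_cases h2 : m.2 = 0 <;> simp [Prod.ext_iff, h1, h2]
  ring

theorem norm_exp_I_mul (x : ℝ) : ‖Complex.exp (Complex.I * x)‖ = 1 := by
  rw [mul_comm, Complex.norm_exp_ofReal_mul_I]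

theorem star_exp_neg (x : ℝ) :
    starRingEnd ℂ (Complex.exp (-(Complex.I * x))) = Complex.exp (Complex.I * x) := by
  rw [← Complex.exp_conj]; simp

theorem continuous_pairing (m : ℤ × ℤ) : Continuous (pairing m) := by
  unfold pairing; fun_prop

theorem inner_mode (m : ℤ × ℤ) (h : L2 ϖ) (g : BochnerL2 ϖ) :
    inner ℂ (memLp_mode ϖ m h).toLp g =
      ∫ η, Complex.exp (Complex.I * pairing m η) * inner ℂ h (g η) ∂floquetMeasure := by
  rw [L2.inner_def]
  refine integral_congr_ae ?_
  filter_upwards [(memLp_mode ϖ m h).coeFn_toLp] with η hη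
  rw [hη, inner_smul_left, star_exp_neg]

theorem inner_mode_mode (m n : ℤ × ℤ) (h h' : L2 ϖ) :
    inner ℂ (memLp_mode ϖ m h).toLp (memLp_mode ϖ n h').toLp =
      (if m = n then (4 * Real.pi ^ 2 : ℂ) else 0) * inner ℂ h h' := by
  rw [inner_mode]
  have := integral_exp_pairing (m - n)
  simp only [sub_eq_zero] at this
  rw [← this, ← integral_mul_const]
  refine integral_congr_ae ?_
  filter_upwards [(memLp_mode ϖ n h').coeFn_toLp] with η hη
  rw [hη, inner_smul_right, ← mul_assoc, ← Complex.exp_add, pairing_sub]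
  push_cast; ring_nf

/-- The normalized mode `h ↦ (2π)⁻¹ exp(-i η·m) h`. -/
def modeL (ϖ : Set ℂ) (m : ℤ × ℤ) : L2 ϖ →ₗᵢ[ℂ] BochnerL2 ϖ where
  toFun h := (1 / (2 * Real.pi) : ℂ) • (memLp_mode ϖ m h).toLp
  map_add' h h' := by
    rw [← smul_add, ← MemLp.toLp_add]
    congr 1
    refine MemLp.toLp_congr _ _ (Eventually.of_forall fun η => ?_)
    simp
  map_smul' c h := by
    rw [RingHom.id_apply, smul_comm, ← MemLp.toLp_const_smul c (memLp_mode ϖ m h)]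
    congr 1
    refine MemLp.toLp_congr _ _ (Eventually.of_forall fun η => ?_)
    simp [smul_comm c]
  norm_map' h := by
    have h1 := inner_mode_mode m m h h
    rw [if_pos rfl, inner_self_eq_norm_sq_to_K, inner_self_eq_norm_sq_to_K] at h1
    have h2 : ‖(memLp_mode ϖ m h).toLp‖ ^ 2 = (2 * Real.pi * ‖h‖) ^ 2 := by
      rw [mul_pow]
      have : (4 : ℝ) * Real.pi ^ 2 = (2 * Real.pi) ^ 2 := by ring
      rw [← this]
      apply Complex.ofReal_injective
      push_cast
      exact h1
    have h3 := (pow_left_inj₀ (norm_nonneg _) (by positivity) two_ne_zero).1 h2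
    change ‖(1 / (2 * Real.pi) : ℂ) • (memLp_mode ϖ m h).toLp‖ = ‖h‖
    rw [norm_smul, h3]
    simp only [one_div, norm_inv, norm_mul, Complex.norm_ofNat, Complex.norm_real, Real.norm_eq_abs,
      abs_of_pos Real.pi_pos]
    field_simp

theorem modeL_apply (m : ℤ × ℤ) (h : L2 ϖ) :
    modeL ϖ m h = (1 / (2 * Real.pi) : ℂ) • (memLp_mode ϖ m h).toLp := rfl

theorem orthogonalFamily_mode (ϖ : Set ℂ) :
    OrthogonalFamily ℂ (fun _ : ℤ × ℤ => L2 ϖ) (modeL ϖ) := by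
  intro m n hmn h h'
  rw [modeL_apply, modeL_apply, inner_smul_left, inner_smul_right, inner_mode_mode, if_neg hmn]
  simp

/-- The Floquet transform as an isometry. -/
def floquetL (hϖ : IsPeriodicCell ϖ)
    (hnull : volume (periodicDomain ϖ \ ⋃ m, cellTranslate ϖ m) = 0) :
    L2 (periodicDomain ϖ) →ₗᵢ[ℂ] BochnerL2 ϖ :=
  (orthogonalFamily_mode ϖ).linearIsometry.comp (cellSeq hϖ hnull)

theorem hasSum_floquetL (hϖ : IsPeriodicCell ϖ)
    (hnull : volume (periodicDomain ϖ \ ⋃ m, cellTranslate ϖ m) = 0) (f : L2 (periodicDomain ϖ)) :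
    HasSum (fun m => modeL ϖ m (cellPart ϖ m f)) (floquetL hϖ hnull f) :=
  (orthogonalFamily_mode ϖ).hasSum_linearIsometry (cellSeq hϖ hnull f)

/-- The orthogonal family supplies convergence, so the infinite sum in `floquet` is a genuine limit
and not the default value. -/
theorem floquet_eq (hϖ : IsPeriodicCell ϖ)
    (hnull : volume (periodicDomain ϖ \ ⋃ m, cellTranslate ϖ m) = 0) (f : L2 (periodicDomain ϖ)) :
    floquet ϖ f = floquetL hϖ hnull f := by
  rw [← (hasSum_floquetL hϖ hnull f).tsum_eq, floquet]
  simp only [modeL_apply]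
  rw [tsum_const_smul'']

/-- The adjoint of the Floquet transform. -/
def floquetAdj (hϖ : IsPeriodicCell ϖ)
    (hnull : volume (periodicDomain ϖ \ ⋃ m, cellTranslate ϖ m) = 0) :
    BochnerL2 ϖ →L[ℂ] L2 (periodicDomain ϖ) :=
  ContinuousLinearMap.adjoint (floquetL hϖ hnull).toContinuousLinearMap

theorem inner_floquetAdj (hϖ : IsPeriodicCell ϖ)
    (hnull : volume (periodicDomain ϖ \ ⋃ m, cellTranslate ϖ m) = 0) (f : L2 (periodicDomain ϖ))
    (g : BochnerL2 ϖ) : inner ℂ f (floquetAdj hϖ hnull g) = inner ℂ (floquetL hϖ hnull f) g :=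
  ContinuousLinearMap.adjoint_inner_right _ _ _

theorem floquetAdj_floquetL (hϖ : IsPeriodicCell ϖ)
    (hnull : volume (periodicDomain ϖ \ ⋃ m, cellTranslate ϖ m) = 0) (f : L2 (periodicDomain ϖ)) :
    floquetAdj hϖ hnull (floquetL hϖ hnull f) = f := by
  refine ext_inner_left ℂ fun h => ?_
  rw [inner_floquetAdj, LinearIsometry.inner_map_map]

theorem integrable_coe (g : BochnerL2 ϖ) : Integrable g floquetMeasure :=
  (Lp.memLp g).integrable one_le_two

theorem integrable_exp_smul {E : Type*} [NormedAddCommGroup E] [NormedSpace ℂ E]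
    {g : ℝ × ℝ → E} (hg : Integrable g floquetMeasure) (m : ℤ × ℤ) :
    Integrable (fun η => Complex.exp (Complex.I * pairing m η) • g η) floquetMeasure := by
  refine hg.bdd_smul 1 ?_ (Eventually.of_forall fun η => (norm_exp_I_mul _).le)
  have := continuous_pairing m
  exact Continuous.aestronglyMeasurable (by fun_prop)

/-- Tested against a function living on the single cell `n`, whose Floquet transform is one mode,
the adjoint reduces to a Fourier coefficient in `η`. -/
theorem cellPart_floquetAdj (hϖ : IsPeriodicCell ϖ)
    (hnull : volume (periodicDomain ϖ \ ⋃ m, cellTranslate ϖ m) = 0) (n : ℤ × ℤ)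
    (g : BochnerL2 ϖ) : cellPart ϖ n (floquetAdj hϖ hnull g) = (1 / (2 * Real.pi) : ℂ) •
      ∫ η, Complex.exp (Complex.I * pairing n η) • g η ∂floquetMeasure := by
  refine ext_inner_left ℂ fun h => ?_
  obtain ⟨e, he, he'⟩ := exists_cellPart_eq_single hϖ n h
  have h1 : inner ℂ e (floquetAdj hϖ hnull g) = inner ℂ h (cellPart ϖ n (floquetAdj hϖ hnull g)) := by
    rw [inner_eq_tsum_cellPart hϖ hnull, tsum_eq_single n fun m hm => by rw [he' m hm, inner_zero_left],
      he]
  have h2 : floquetL hϖ hnull e = modeL ϖ n h := by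
    refine (hasSum_floquetL hϖ hnull e).unique ?_
    convert hasSum_single n ?_ using 1
    · rw [he]
    · intro m hm; rw [he' m hm, map_zero]
  rw [← h1, inner_floquetAdj, h2, modeL_apply, inner_smul_left, inner_mode, inner_smul_right,
    ← integral_inner (integrable_exp_smul (integrable_coe g) n)]
  simp [inner_smul_right, map_ofNat]

theorem floquetInv_ae_eq (hϖ : IsPeriodicCell ϖ)
    (hnull : volume (periodicDomain ϖ \ ⋃ m, cellTranslate ϖ m) = 0) (g : BochnerL2 ϖ) :
    floquetAdj hϖ hnull g =ᵐ[volume.restrict (periodicDomain ϖ)] floquetInv ϖ g := by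
  refine (hϖ.ae_periodicDomain_iff hnull).2 fun m => ?_
  filter_upwards [coeFn_cellPart hϖ m (floquetAdj hϖ hnull g),
    ae_restrict_mem hϖ.isOpen.measurableSet] with z h1 h2
  have h3 := hϖ.subset_unitSquare h2
  rw [← h1, floquetInv, tr_add_lat, intPart_add_lat_of_mem h3, tr_eq_self h3,
    cellPart_floquetAdj hϖ hnull]

/-! ### Lattice sums of translates of a holomorphic function. -/

/-- A series converging both in `L²` and pointwise almost everywhere has the same sum. -/
theorem ae_eq_of_hasSum {α E ι : Type*} [MeasurableSpace α] {μ : Measure α} [NormedAddCommGroup E]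
    [Countable ι] {F : ι → Lp E 2 μ} {S : Lp E 2 μ} (hF : HasSum F S) {f : ι → α → E}
    (hf : ∀ i, F i =ᵐ[μ] f i) {s : α → E} (hs : ∀ᵐ x ∂μ, HasSum (fun i => f i x) (s x)) :
    S =ᵐ[μ] s := by
  obtain ⟨ns, hns, hae⟩ := (tendstoInMeasure_of_tendsto_Lp hF).exists_seq_tendsto_ae'
  have h1 : ∀ᵐ x ∂μ, ∀ i, F i x = f i x := ae_all_iff.2 hf
  have h2 : ∀ᵐ x ∂μ, ∀ n, (∑ i ∈ ns n, F i : Lp E 2 μ) x = ∑ i ∈ ns n, F i x :=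
    ae_all_iff.2 fun n => by
      filter_upwards [Lp.coeFn_fun_finsetSum (ns n) F] with x hx using hx
  filter_upwards [hae, h1, h2, hs] with x h3 h4 h5 h6
  refine tendsto_nhds_unique h3 ?_
  simp only [h5, h4]
  exact h6.comp hns

theorem finset_sum_sq_le {ι : Type*} (s : Finset ι) (x : ι → ℝ≥0∞) :
    ∑ i ∈ s, x i ^ 2 ≤ (∑ i ∈ s, x i) ^ 2 := by
  rw [sq, Finset.sum_mul]
  refine Finset.sum_le_sum fun i hi => ?_
  rw [sq]
  gcongr
  exact Finset.single_le_sum (fun _ _ => zero_le) hi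

theorem finite_intPart_image_ball (z : ℂ) (R : ℝ) : (intPart '' Metric.ball z R).Finite := by
  refine ((isCompact_closedBall (0 : ℤ × ℤ) (3 * (1 + (‖z‖ + R)))).finite_of_discrete).subset ?_
  rintro _ ⟨w, hw, rfl⟩
  rw [mem_closedBall_zero_iff]
  have h1 := one_add_norm_intPart_le w
  have h2 : ‖w‖ ≤ ‖z‖ + R := by
    have h3 : ‖w‖ ≤ ‖z‖ + ‖w - z‖ := by simpa using norm_add_le z (w - z)
    rw [mem_ball_iff_norm] at hw
    linarith
  linarith

/-- Local bound for the translates of a holomorphic function by its norms on the cells. -/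
theorem exists_translate_bound (hϖ : IsPeriodicCell ϖ)
    (hnull : volume (periodicDomain ϖ \ ⋃ m, cellTranslate ϖ m) = 0) {U : L2 (periodicDomain ϖ)}
    {u : ℂ → ℂ} (hu : DifferentiableOn ℂ u (periodicDomain ϖ))
    (hUu : U =ᵐ[volume.restrict (periodicDomain ϖ)] u) {z : ℂ} (hz : z ∈ periodicDomain ϖ) :
    ∃ r > 0, ∃ J : Finset (ℤ × ℤ), Metric.ball z r ⊆ periodicDomain ϖ ∧
      ∀ w ∈ Metric.ball z r, ∀ l, ‖u (w + lat l)‖ ≤ 2 / r * ∑ j ∈ J, ‖cellPart ϖ (l + j) U‖ := by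
  obtain ⟨R, hR, hzR⟩ := Metric.isOpen_iff.1 (isOpen_periodicDomain ϖ) z hz
  -- The disc of radius `R / 2` about `w + l` lies in the `l`-translate of `ball z R`. It therefore
  -- meets only cells `l + j` with `j` in a finite set `J` independent of `w` and `l`.
  refine ⟨R / 2, by positivity, (finite_intPart_image_ball z R).toFinset,
    (Metric.ball_subset_ball (by linarith)).trans hzR, fun w hw l => ?_⟩
  set J := (finite_intPart_image_ball z R).toFinset with hJ
  have hin : ∀ y ∈ Metric.ball (w + lat l) (R / 2), y - lat l ∈ Metric.ball z R := by
    intro y hy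
    rw [Metric.mem_ball] at *
    have h1 : dist (y - lat l) w = dist y (w + lat l) := by
      rw [dist_eq_norm, dist_eq_norm]; congr 1; ring
    linarith [dist_triangle (y - lat l) w z]
  have hsub : Metric.ball (w + lat l) (R / 2) ⊆ periodicDomain ϖ := fun y hy =>
    (sub_lat_mem l).1 (hzR (hin y hy))
  refine sq_norm_holomorphic_le (by positivity) (hu.mono hsub)
    (Finset.sum_nonneg fun _ _ => norm_nonneg _) ?_
  set B := Metric.ball (w + lat l) (R / 2) with hB
  have h1 : ∫⁻ y in B, ‖u y‖ₑ ^ 2 = ∫⁻ y in periodicDomain ϖ, B.indicator (fun y => ‖u y‖ₑ ^ 2) y := by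
    rw [lintegral_indicator Metric.isOpen_ball.measurableSet,
      Measure.restrict_restrict Metric.isOpen_ball.measurableSet, inter_eq_left.2 hsub]
  rw [h1, hϖ.lintegral_periodicDomain hnull, ← (Equiv.addLeft l).tsum_eq, tsum_eq_sum (s := J)]
  · rw [ENNReal.ofReal_sum_of_nonneg fun _ _ => norm_nonneg _]
    refine le_trans (Finset.sum_le_sum fun j _ => ?_) (finset_sum_sq_le _ _)
    rw [ofReal_norm, enorm_Lp_two_sq]
    refine lintegral_mono_ae ?_
    filter_upwards [cellPart_eq_of_ae hϖ (l + j) hUu] with y hy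
    rw [hy]
    exact indicator_le_self _ _ _
  · intro j hj
    rw [setLIntegral_congr_fun hϖ.isOpen.measurableSet (g := fun _ => 0), lintegral_zero]
    intro y hy
    refine indicator_of_notMem (fun h => hj ?_) _
    rw [hJ, Finite.mem_toFinset]
    refine ⟨_, hin _ h, ?_⟩
    rw [Equiv.coe_addLeft, lat_add, show y + (lat l + lat j) - lat l = y + lat j by ring,
      intPart_add_lat_of_mem (hϖ.subset_unitSquare hy)]

section lattice_sum

variable {U : L2 (periodicDomain ϖ)} {u : ℂ → ℂ} {c : ℤ × ℤ → ℂ} {B : ℝ}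

theorem summable_comp_add_right {N : ℤ × ℤ → ℝ} (h : Summable N) (j : ℤ × ℤ) :
    Summable fun l => N (l + j) := (Equiv.addRight j).summable_iff.2 h

theorem summable_lattice (hϖ : IsPeriodicCell ϖ)
    (hnull : volume (periodicDomain ϖ \ ⋃ m, cellTranslate ϖ m) = 0)
    (hu : DifferentiableOn ℂ u (periodicDomain ϖ))
    (hUu : U =ᵐ[volume.restrict (periodicDomain ϖ)] u)
    (hU : Summable fun m => ‖cellPart ϖ m U‖) (hc : ∀ l, ‖c l‖ ≤ B) {z : ℂ}
    (hz : z ∈ periodicDomain ϖ) : Summable fun l => c l * u (z + lat l) := by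
  obtain ⟨r, hr, J, -, h⟩ := exists_translate_bound hϖ hnull hu hUu hz
  refine Summable.of_norm_bounded
    (((summable_sum (s := J) fun j _ => summable_comp_add_right hU j).mul_left (2 / r)).mul_left B) fun l => ?_
  rw [norm_mul]
  exact mul_le_mul (hc l) (h z (Metric.mem_ball_self hr) l) (norm_nonneg _)
    ((norm_nonneg _).trans (hc l))

/-- Weierstrass test: the translate bound is uniform on a disc and summable in `l`. Only boundedness
of the coefficients matters, which allows both exponentials and Fourier coefficients of indicators.
-/
theorem differentiableOn_lattice_sum (hϖ : IsPeriodicCell ϖ)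
    (hnull : volume (periodicDomain ϖ \ ⋃ m, cellTranslate ϖ m) = 0)
    (hu : DifferentiableOn ℂ u (periodicDomain ϖ))
    (hUu : U =ᵐ[volume.restrict (periodicDomain ϖ)] u)
    (hU : Summable fun m => ‖cellPart ϖ m U‖) (hc : ∀ l, ‖c l‖ ≤ B) :
    DifferentiableOn ℂ (fun z => ∑' l, c l * u (z + lat l)) (periodicDomain ϖ) := by
  intro z hz
  obtain ⟨r, hr, J, hsub, h⟩ := exists_translate_bound hϖ hnull hu hUu hz
  have h1 : DifferentiableOn ℂ (fun z => ∑' l, c l * u (z + lat l)) (Metric.ball z r) := by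
    refine Complex.differentiableOn_tsum_of_summable_norm
      (((summable_sum (s := J) fun j _ => summable_comp_add_right hU j).mul_left (2 / r)).mul_left B)
      (fun l => ?_) Metric.isOpen_ball fun l w hw => ?_
    · refine DifferentiableOn.const_mul ?_ _
      refine hu.comp (by fun_prop) fun w hw => (add_lat_mem l).2 (hsub hw)
    · rw [norm_mul]
      exact mul_le_mul (hc l) (h w hw l) (norm_nonneg _) ((norm_nonneg _).trans (hc l))
  exact (h1.differentiableAt (Metric.ball_mem_nhds z hr)).differentiableWithinAt

theorem summable_smul_cellPart (hU : Summable fun m => ‖cellPart ϖ m U‖) (hc : ∀ l, ‖c l‖ ≤ B)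
    (n : ℤ × ℤ) : Summable fun l => c l • cellPart ϖ (n + l) U := by
  refine Summable.of_norm_bounded ((summable_comp_add_right hU n).mul_left B) fun l => ?_
  rw [norm_smul, add_comm n]
  gcongr
  exact hc l

theorem tsum_smul_cellPart_ae_eq (hϖ : IsPeriodicCell ϖ)
    (hnull : volume (periodicDomain ϖ \ ⋃ m, cellTranslate ϖ m) = 0)
    (hu : DifferentiableOn ℂ u (periodicDomain ϖ))
    (hUu : U =ᵐ[volume.restrict (periodicDomain ϖ)] u)
    (hU : Summable fun m => ‖cellPart ϖ m U‖) (hc : ∀ l, ‖c l‖ ≤ B) (n : ℤ × ℤ) :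
    (∑' l, c l • cellPart ϖ (n + l) U : L2 ϖ) =ᵐ[volume.restrict ϖ]
      fun z => ∑' l, c l * u (z + lat n + lat l) := by
  refine ae_eq_of_hasSum (summable_smul_cellPart hU hc n).hasSum
    (f := fun l z => c l * u (z + lat n + lat l)) (fun l => ?_) ?_
  · filter_upwards [Lp.coeFn_smul (c l) (cellPart ϖ (n + l) U), cellPart_eq_of_ae hϖ (n + l) hUu]
      with z h1 h2
    rw [h1, Pi.smul_apply, h2, smul_eq_mul, lat_add, add_assoc]
  · filter_upwards [ae_restrict_mem hϖ.isOpen.measurableSet] with z hz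
    exact (summable_lattice hϖ hnull hu hUu hU hc (hϖ.add_lat_mem hz n)).hasSum

end lattice_sum

/-! ### Decaying functions and their density in the Bergman space. -/

/-- The functions of the Bergman space of the periodic domain with summable norms on the cells. -/
def decaySpace (hϖ : IsPeriodicCell ϖ) : Submodule ℂ (L2 (periodicDomain ϖ)) where
  carrier := {U | U ∈ bergmanSpace (periodicDomain ϖ) ∧ Summable fun m => ‖cellPart ϖ m U‖}
  zero_mem' := ⟨zero_mem _, by
    have : ∀ m, cellPart ϖ m (0 : L2 (periodicDomain ϖ)) = 0 := fun m => by
      have := cellPart_smul hϖ m 0 0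
      simpa using this
    simp only [this, norm_zero]
    exact summable_zero⟩
  add_mem' := by
    rintro f g ⟨h1, h2⟩ ⟨h3, h4⟩
    refine ⟨add_mem h1 h3, (h2.add h4).of_nonneg_of_le (fun _ => norm_nonneg _) fun m => ?_⟩
    rw [cellPart_add hϖ]
    exact norm_add_le _ _
  smul_mem' := by
    rintro c f ⟨h1, h2⟩
    refine ⟨Submodule.smul_mem _ c h1, (h2.mul_left ‖c‖).congr fun m => ?_⟩
    rw [cellPart_smul hϖ, norm_smul]

/-- Multiplication of a uniformly locally square integrable holomorphic function by a decaying
function. -/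
theorem exists_decay_mul (hϖ : IsPeriodicCell ϖ)
    (hnull : volume (periodicDomain ϖ \ ⋃ m, cellTranslate ϖ m) = 0) {Ψ G : ℂ → ℂ} {a : ℤ × ℤ → ℝ}
    (hΨ : DifferentiableOn ℂ Ψ (periodicDomain ϖ)) (ha : Summable a) (ha0 : ∀ m, 0 ≤ a m)
    (hΨa : ∀ᵐ z ∂(volume.restrict (periodicDomain ϖ)), ‖Ψ z‖ ≤ a (intPart z))
    (hG : DifferentiableOn ℂ G (periodicDomain ϖ)) {K : ℝ≥0∞} (hK : K ≠ ∞)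
    (hGK : ∀ m, ∫⁻ z in ϖ, ‖G (z + lat m)‖ₑ ^ 2 ≤ K ^ 2) :
    ∃ U ∈ decaySpace hϖ, U =ᵐ[volume.restrict (periodicDomain ϖ)] fun z => G z * Ψ z := by
  have hd : DifferentiableOn ℂ (fun z => G z * Ψ z) (periodicDomain ϖ) := hG.mul hΨ
  have hcell : ∀ m, ∫⁻ z in ϖ, ‖G (z + lat m) * Ψ (z + lat m)‖ₑ ^ 2 ≤
      (ENNReal.ofReal (a m) * K) ^ 2 := by
    intro m
    calc ∫⁻ z in ϖ, ‖G (z + lat m) * Ψ (z + lat m)‖ₑ ^ 2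
        ≤ ∫⁻ z in ϖ, ENNReal.ofReal (a m) ^ 2 * ‖G (z + lat m)‖ₑ ^ 2 := by
          refine lintegral_mono_ae ?_
          filter_upwards [ae_cell_of_ae hϖ hΨa m, ae_restrict_mem hϖ.isOpen.measurableSet]
            with z h1 h2
          rw [intPart_add_lat_of_mem (hϖ.subset_unitSquare h2)] at h1
          rw [enorm_mul, mul_pow, mul_comm]
          gcongr
          rw [← ofReal_norm]
          exact ENNReal.ofReal_le_ofReal h1
      _ ≤ _ := by
          rw [lintegral_const_mul' _ _ (by finiteness), mul_pow]
          gcongr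
          exact hGK m
  set S : ℝ≥0∞ := ∑' m, ENNReal.ofReal (a m) * K with hS
  have hSt : S ≠ ∞ := by
    rw [hS, ENNReal.tsum_mul_right]
    exact ENNReal.mul_ne_top ha.tsum_ofReal_ne_top hK
  have hmem : MemLp (fun z => G z * Ψ z) 2 (volume.restrict (periodicDomain ϖ)) := by
    refine ⟨hd.continuousOn.aestronglyMeasurable (isOpen_periodicDomain ϖ).measurableSet, ?_⟩
    have h1 : eLpNorm (fun z => G z * Ψ z) 2 (volume.restrict (periodicDomain ϖ)) ^ 2 ≤ S ^ 2 := by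
      rw [eLpNorm_two_sq, hϖ.lintegral_periodicDomain hnull]
      refine (ENNReal.tsum_le_tsum hcell).trans ?_
      -- Nonnegative terms satisfy `∑ x² ≤ (∑ x)²`, so summable cell norms imply square
      -- integrability.
      rw [sq S]
      nth_rewrite 1 [hS]
      rw [← ENNReal.tsum_mul_right]
      refine ENNReal.tsum_le_tsum fun m => ?_
      rw [sq]
      gcongr
      exact ENNReal.le_tsum m
    exact ((ENNReal.pow_le_pow_left_iff two_ne_zero).1 h1).trans_lt hSt.lt_top
  refine ⟨hmem.toLp, ⟨mem_bergmanSpace hd hmem.coeFn_toLp, ?_⟩, hmem.coeFn_toLp⟩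
  refine (ha.mul_right K.toReal).of_nonneg_of_le (fun _ => norm_nonneg _) fun m => ?_
  have h1 : ‖cellPart ϖ m hmem.toLp‖ₑ ^ 2 ≤ (ENNReal.ofReal (a m) * K) ^ 2 := by
    rw [enorm_Lp_two_sq]
    refine le_trans (le_of_eq (lintegral_congr_ae ?_)) (hcell m)
    filter_upwards [cellPart_eq_of_ae hϖ m hmem.coeFn_toLp] with z hz
    rw [hz]
  have h2 := (ENNReal.pow_le_pow_left_iff two_ne_zero).1 h1
  have h3 := ENNReal.toReal_mono (by finiteness) h2
  rwa [toReal_enorm, ENNReal.toReal_mul, ENNReal.toReal_ofReal (ha0 m)] at h3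

theorem ae_forall_sub_lat_periodicDomain (hϖ : IsPeriodicCell ϖ)
    (hnull : volume (periodicDomain ϖ \ ⋃ m, cellTranslate ϖ m) = 0) {p : ℂ → Prop}
    (h : ∀ᵐ z ∂(volume.restrict (periodicDomain ϖ)), p z) :
    ∀ᵐ z ∂(volume.restrict (periodicDomain ϖ)), ∀ m, p (z - lat m) := by
  refine ae_all_iff.2 fun m => (hϖ.ae_periodicDomain_iff hnull).2 fun n => ?_
  filter_upwards [ae_cell_of_ae hϖ h (n - m)] with z hz
  rwa [lat_sub, ← add_sub_assoc] at hz

/-- The decaying functions are dense in the Bergman space of the periodic domain. -/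
theorem bergmanSpace_le_closure_decaySpace (hϖ : IsPeriodicCell ϖ) (hA : ConditionA ϖ)
    (hnull : volume (periodicDomain ϖ \ ⋃ m, cellTranslate ϖ m) = 0) :
    bergmanSpace (periodicDomain ϖ) ≤ (decaySpace hϖ).topologicalClosure := by
  obtain ⟨Ψ, a, hΨ, ha, ha0, hΨa, hone⟩ := hA.exists_partition hϖ hnull
  intro f hf
  obtain ⟨g, hg, hfg⟩ := id hf
  have hΨa' := ae_forall_sub_lat_periodicDomain hϖ hnull hΨa
  -- The approximants are the finite partial sums of the pieces `g Ψ(· - p)`.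
  have hU : ∀ p, ∃ U ∈ decaySpace hϖ,
      U =ᵐ[volume.restrict (periodicDomain ϖ)] fun z => g z * Ψ (z - lat p) := by
    intro p
    refine exists_decay_mul hϖ hnull (a := fun n => a (n + -p)) (K := ‖f‖ₑ)
      (hΨ.comp (by fun_prop) fun z hz => (sub_lat_mem p).2 hz) (summable_comp_add_right ha (-p))
      (fun m => ha0 _) ?_ hg enorm_ne_top fun m => ?_
    · filter_upwards [hΨa'] with z hz
      have := hz p
      rwa [sub_eq_add_neg z, ← lat_neg, intPart_add_lat, lat_neg, ← sub_eq_add_neg z] at this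
    · rw [← tsum_enorm_cellPart hϖ hnull]
      refine le_trans (le_of_eq ?_) (ENNReal.le_tsum m)
      rw [enorm_Lp_two_sq]
      refine lintegral_congr_ae ?_
      filter_upwards [cellPart_eq_of_ae hϖ m hfg] with z hz
      rw [hz]
  choose U hUd hUg using hU
  have hUall : ∀ᵐ z ∂(volume.restrict (periodicDomain ϖ)), ∀ p, U p z = g z * Ψ (z - lat p) :=
    ae_all_iff.2 hUg
  have hsumU : ∀ᵐ z ∂(volume.restrict (periodicDomain ϖ)), ∀ s : Finset (ℤ × ℤ),
      (∑ p ∈ s, U p : L2 (periodicDomain ϖ)) z = ∑ p ∈ s, U p z :=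
    ae_all_iff.2 fun s => by
      filter_upwards [Lp.coeFn_fun_finsetSum s U] with x hx using hx
  have hdiff : ∀ᵐ z ∂(volume.restrict (periodicDomain ϖ)), ∀ s : Finset (ℤ × ℤ),
      (f - ∑ p ∈ s, U p : L2 (periodicDomain ϖ)) z = f z - ∑ p ∈ s, f z * Ψ (z - lat p) := by
    have h1 : ∀ᵐ z ∂(volume.restrict (periodicDomain ϖ)), ∀ s : Finset (ℤ × ℤ),
      (f - ∑ p ∈ s, U p : L2 (periodicDomain ϖ)) z =
        f z - (∑ p ∈ s, U p : L2 (periodicDomain ϖ)) z :=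
      ae_all_iff.2 fun s => Lp.coeFn_sub _ _
    filter_upwards [h1, hsumU, hUall, hfg] with z h1 h2 h3 h4 s
    rw [h1, h2, h4]
    simp only [h3]
  -- Dominated convergence: the factor `1 - ∑_{p ∈ s} Ψ(z - p)` tends to `0` almost everywhere and
  -- is bounded by `1 + ∑ a` for every finite `s`.
  have htend : Tendsto (fun s : Finset (ℤ × ℤ) => ‖f - ∑ p ∈ s, U p‖ₑ ^ 2) atTop (𝓝 0) := by
    simp only [enorm_Lp_two_sq]
    rw [← lintegral_zero (μ := volume.restrict (periodicDomain ϖ))]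
    set A := ∑' m, a m
    refine tendsto_lintegral_filter_of_dominated_convergence
      (fun z => ENNReal.ofReal (1 + A) ^ 2 * ‖f z‖ₑ ^ 2) (Eventually.of_forall fun s => ?_)
      (Eventually.of_forall fun s => ?_) ?_ ?_
    · exact (Lp.stronglyMeasurable (f - ∑ p ∈ s, U p)).enorm.pow_const 2
    · filter_upwards [hdiff, hΨa'] with z h1 h2
      rw [h1, ← Finset.mul_sum, show f z - f z * ∑ p ∈ s, Ψ (z - lat p) =
        (1 - ∑ p ∈ s, Ψ (z - lat p)) * f z by ring, enorm_mul, mul_pow]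
      gcongr
      rw [← ofReal_norm]
      refine ENNReal.ofReal_le_ofReal ((norm_sub_le _ _).trans ?_)
      rw [norm_one]
      gcongr
      refine (norm_sum_le _ _).trans ?_
      have h3 : HasSum (fun p => a (intPart z - p)) A :=
        (Equiv.subLeft (intPart z)).hasSum_iff.2 ha.hasSum
      refine le_trans (Finset.sum_le_sum fun p _ => ?_) (sum_le_hasSum s (fun p _ => ha0 _) h3)
      have := h2 p
      rwa [sub_eq_add_neg z, ← lat_neg, intPart_add_lat, lat_neg, ← sub_eq_add_neg z,
        ← sub_eq_add_neg] at this
    · rw [lintegral_const_mul' _ _ (by finiteness), ← enorm_Lp_two_sq]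
      finiteness
    · filter_upwards [hdiff, hone] with z h1 h2
      simp only [h1]
      have h3 : Tendsto (fun s : Finset (ℤ × ℤ) => f z - ∑ p ∈ s, f z * Ψ (z - lat p)) atTop
          (𝓝 (f z - f z * 1)) := tendsto_const_nhds.sub (h2.mul_left (f z))
      rw [mul_one, sub_self] at h3
      have h4 := (ENNReal.continuous_pow 2).tendsto 0
      have h5 := h4.comp (by simpa using h3.enorm)
      simpa [Function.comp_def] using h5
  refine mem_closure_of_tendsto (b := atTop) (f := fun s : Finset (ℤ × ℤ) => ∑ p ∈ s, U p) ?_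
    (Eventually.of_forall fun s => sum_mem fun p _ => hUd p)
  rw [tendsto_iff_edist_tendsto_0]
  have h1 := (ENNReal.continuous_rpow_const (y := (1 / 2 : ℝ))).tendsto 0 |>.comp htend
  refine (h1.congr fun s => ?_).trans_eq (by simp)
  rw [Function.comp_apply, ← ENNReal.rpow_natCast, ← ENNReal.rpow_mul, edist_comm, edist_eq_enorm_sub]
  norm_num

/-! ### Sections of decaying functions. -/

/-- The pointwise defined Floquet series of a decaying function (without the factor `(2π)⁻¹`). -/
def decaySection (ϖ : Set ℂ) (U : L2 (periodicDomain ϖ)) (η : ℝ × ℝ) : L2 ϖ :=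
  ∑' l : ℤ × ℤ, Complex.exp (-(Complex.I * pairing l η)) • cellPart ϖ l U

theorem norm_exp_neg_I_mul (x : ℝ) : ‖Complex.exp (-(Complex.I * x))‖ = 1 := by
  rw [Complex.norm_exp]; simp

section

variable {U : L2 (periodicDomain ϖ)}

theorem summable_decaySection (hU : Summable fun m => ‖cellPart ϖ m U‖) (η : ℝ × ℝ) :
    Summable fun l => Complex.exp (-(Complex.I * pairing l η)) • cellPart ϖ l U :=
  Summable.of_norm_bounded hU fun l => by rw [norm_smul, norm_exp_neg_I_mul, one_mul]

theorem norm_decaySection_le (hU : Summable fun m => ‖cellPart ϖ m U‖) (η : ℝ × ℝ) :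
    ‖decaySection ϖ U η‖ ≤ ∑' m, ‖cellPart ϖ m U‖ :=
  tsum_of_norm_bounded hU.hasSum fun l => by rw [norm_smul, norm_exp_neg_I_mul, one_mul]

theorem continuous_decaySection (hU : Summable fun m => ‖cellPart ϖ m U‖) :
    Continuous (decaySection ϖ U) := by
  refine continuous_tsum (fun l => ?_) hU fun l η => by rw [norm_smul, norm_exp_neg_I_mul, one_mul]
  have := continuous_pairing l
  fun_prop

/-- The lattice sum is holomorphic on all of `Ω`, and reindexing `l ↦ l + m` produces the
quasiperiodicity factor. -/
theorem decaySection_mem_quasiExt (hϖ : IsPeriodicCell ϖ)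
    (hnull : volume (periodicDomain ϖ \ ⋃ m, cellTranslate ϖ m) = 0) (hU : U ∈ decaySpace hϖ)
    (η : ℝ × ℝ) : decaySection ϖ U η ∈ quasiExt ϖ η := by
  obtain ⟨⟨u, hu, hUu⟩, hs⟩ := hU
  have hc : ∀ l, ‖Complex.exp (-(Complex.I * pairing l η))‖ ≤ 1 := fun l =>
    (norm_exp_neg_I_mul _).le
  refine mem_quasiExt hϖ (differentiableOn_lattice_sum hϖ hnull hu hUu hs hc) ?_ fun z m => ?_
  · have := tsum_smul_cellPart_ae_eq hϖ hnull hu hUu hs hc 0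
    simpa [decaySection] using this
  · rw [← (Equiv.addRight m).tsum_eq (fun l => Complex.exp (-(Complex.I * pairing l η)) *
      u (z + lat l)), ← tsum_mul_left]
    refine tsum_congr fun l => ?_
    rw [Equiv.coe_addRight, ← mul_assoc, ← Complex.exp_add, pairing_add, lat_add, add_assoc,
      add_comm (lat m)]
    congr 2
    push_cast; ring

/-- Provides a representative of the transform that is defined for every `η` and continuous in `η`,
which makes evaluation at individual fibres meaningful. -/
theorem floquetL_decay (hϖ : IsPeriodicCell ϖ)
    (hnull : volume (periodicDomain ϖ \ ⋃ m, cellTranslate ϖ m) = 0) (hU : U ∈ decaySpace hϖ) :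
    floquetL hϖ hnull U =ᵐ[floquetMeasure] fun η =>
      (1 / (2 * Real.pi) : ℂ) • decaySection ϖ U η := by
  refine ae_eq_of_hasSum (hasSum_floquetL hϖ hnull U) (f := fun l η =>
    (1 / (2 * Real.pi) : ℂ) • Complex.exp (-(Complex.I * pairing l η)) • cellPart ϖ l U)
    (fun l => ?_) ?_
  · rw [modeL_apply]
    filter_upwards [Lp.coeFn_smul (1 / (2 * Real.pi) : ℂ) (memLp_mode ϖ l (cellPart ϖ l U)).toLp,
      (memLp_mode ϖ l (cellPart ϖ l U)).coeFn_toLp] with η h1 h2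
    rw [h1, Pi.smul_apply, h2]
  · exact Eventually.of_forall fun η => (summable_decaySection hU.2 η).hasSum.const_smul _

/-- Every element of `A²_{η,ext}` is the value at `η` of a section from a decaying function. -/
theorem exists_decaySection_eq (hϖ : IsPeriodicCell ϖ) (hA : ConditionA ϖ)
    (hnull : volume (periodicDomain ϖ \ ⋃ m, cellTranslate ϖ m) = 0) {η : ℝ × ℝ} {f : L2 ϖ}
    (hf : f ∈ quasiExt ϖ η) : ∃ U ∈ decaySpace hϖ, decaySection ϖ U η = f := by
  obtain ⟨Ψ, a, hΨ, ha, ha0, hΨa, hone⟩ := hA.exists_partition hϖ hnull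
  obtain ⟨G, hG, hfG, hper⟩ := exists_quasiperiodic_extension hϖ hf
  -- The multipliers have modulus `1`, so `G` has the norm of `f` on every cell, and `U = G Ψ`
  -- decays.
  obtain ⟨U, hU, hUg⟩ := exists_decay_mul hϖ hnull hΨ ha ha0 hΨa hG (K := ‖f‖ₑ) enorm_ne_top
    fun m => by
      rw [enorm_Lp_two_sq]
      refine le_of_eq (lintegral_congr_ae ?_)
      filter_upwards [hfG] with z hz
      rw [hper, hz, enorm_mul, ← ofReal_norm, norm_exp_I_mul]
      simp
  refine ⟨U, hU, ?_⟩
  have hc : ∀ l, ‖Complex.exp (-(Complex.I * pairing l η))‖ ≤ 1 := fun l =>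
    (norm_exp_neg_I_mul _).le
  have h1 := tsum_smul_cellPart_ae_eq hϖ hnull (hG.mul hΨ) hUg hU.2 hc 0
  have h2 := ae_cell_of_ae hϖ hone 0
  apply Lp.ext
  simp only [zero_add, lat_zero, add_zero] at h1 h2
  filter_upwards [h1, h2, hfG] with z h1 h2 h3
  rw [decaySection, h1, h3]
  -- The exponentials cancel the multipliers of `G`, leaving `G(z) ∑ Ψ(z + l) = G(z)`.
  have h4 : HasSum (fun l => Ψ (z + lat l)) 1 := by
    rw [← (Equiv.neg (ℤ × ℤ)).hasSum_iff]
    simpa [Function.comp_def, lat_neg, sub_eq_add_neg] using h2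
  have h5 := h4.mul_left (G z)
  rw [mul_one] at h5
  rw [← h5.tsum_eq]
  refine tsum_congr fun l => ?_
  simp only [Pi.mul_apply]
  rw [hper, ← mul_assoc, ← mul_assoc, ← Complex.exp_add]
  simp

theorem memLp_indicator_decaySection (hU : Summable fun m => ‖cellPart ϖ m U‖) {A : Set (ℝ × ℝ)}
    (hA : MeasurableSet A) : MemLp (A.indicator (decaySection ϖ U)) 2 floquetMeasure :=
  (MemLp.of_bound (continuous_decaySection hU).aestronglyMeasurable _
    (Eventually.of_forall (norm_decaySection_le hU))).indicator hA

/-- The adjoint Floquet transform of a section over a measurable set is holomorphic. -/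
theorem floquetAdj_indicator_decaySection_mem (hϖ : IsPeriodicCell ϖ)
    (hnull : volume (periodicDomain ϖ \ ⋃ m, cellTranslate ϖ m) = 0) (hU : U ∈ decaySpace hϖ)
    {A : Set (ℝ × ℝ)} (hA : MeasurableSet A) :
    floquetAdj hϖ hnull (memLp_indicator_decaySection hU.2 hA).toLp ∈
      bergmanSpace (periodicDomain ϖ) := by
  obtain ⟨⟨u, hu, hUu⟩, hs⟩ := id hU
  -- Integrating over `A` term by term replaces the exponentials by Fourier coefficients of the
  -- indicator of `A`; the result is again a lattice sum with bounded coefficients.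
  set b : ℤ × ℤ → ℂ := fun j => ∫ η in A, Complex.exp (-(Complex.I * pairing j η)) ∂floquetMeasure
    with hb
  set c : ℤ × ℤ → ℂ := fun j => (1 / (2 * Real.pi) : ℂ) * b j with hc
  have hcb : ∀ j, ‖c j‖ ≤ ‖(1 / (2 * Real.pi) : ℂ)‖ * (1 * (floquetMeasure.restrict A).real univ) := by
    intro j
    rw [hc, norm_mul]
    gcongr
    exact norm_integral_le_of_norm_le_const (Eventually.of_forall fun η => (norm_exp_neg_I_mul _).le)
  refine mem_bergmanSpace (differentiableOn_lattice_sum hϖ hnull hu hUu hs hcb) ?_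
  refine (hϖ.ae_periodicDomain_iff hnull).2 fun n => ?_
  have key : cellPart ϖ n (floquetAdj hϖ hnull (memLp_indicator_decaySection hU.2 hA).toLp) =
      ∑' l, c l • cellPart ϖ (n + l) U := by
    rw [cellPart_floquetAdj]
    simp only [hc, mul_smul]
    rw [tsum_const_smul'']
    congr 1
    have h1 : ∫ η, Complex.exp (Complex.I * pairing n η) •
        ((memLp_indicator_decaySection hU.2 hA).toLp : BochnerL2 ϖ) η ∂floquetMeasure =
        ∫ η in A, ∑' l, Complex.exp (-(Complex.I * pairing l η)) • cellPart ϖ (n + l) U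
          ∂floquetMeasure := by
      rw [← integral_indicator hA]
      refine integral_congr_ae ?_
      filter_upwards [(memLp_indicator_decaySection hU.2 hA).coeFn_toLp] with η hη
      rw [hη]
      by_cases hηA : η ∈ A
      · rw [indicator_of_mem hηA, indicator_of_mem hηA, decaySection, ← tsum_const_smul'',
          ← (Equiv.addLeft n).tsum_eq]
        refine tsum_congr fun l => ?_
        rw [Equiv.coe_addLeft, smul_smul, ← Complex.exp_add, pairing_add]
        congr 2
        push_cast; ring
      · rw [indicator_of_notMem hηA, indicator_of_notMem hηA, smul_zero]
    rw [h1]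
    have hI : ∀ l, Integrable (fun η => Complex.exp (-(Complex.I * pairing l η)))
        (floquetMeasure.restrict A) := by
      intro l
      have := continuous_pairing l
      exact Integrable.of_bound (Continuous.aestronglyMeasurable (by fun_prop)) 1
        (Eventually.of_forall fun η => (norm_exp_neg_I_mul _).le)
    refine (hasSum_integral_of_summable_integral_norm (fun l => (hI l).smul_const _) ?_).tsum_eq.symm.trans
      (tsum_congr fun l => integral_smul_const _ _)
    simp only [norm_smul, norm_exp_neg_I_mul, one_mul, integral_const]
    simp only [smul_eq_mul]
    refine Summable.mul_left _ ?_
    have := summable_comp_add_right hs n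
    simpa only [add_comm] using this
  have h2 := tsum_smul_cellPart_ae_eq hϖ hnull hu hUu hs hcb n
  rw [← key] at h2
  filter_upwards [h2, coeFn_cellPart hϖ n
    (floquetAdj hϖ hnull (memLp_indicator_decaySection hU.2 hA).toLp)] with z h3 h4
  rw [← h4, h3]

end

/-! ### Fibrewise orthogonality and the intertwining relation. -/

/-- A function orthogonal to all sections over measurable sets is fibrewise orthogonal. -/
theorem ae_inner_quasiSpace_eq_zero (hϖ : IsPeriodicCell ϖ) (hA : ConditionA ϖ)
    (hnull : volume (periodicDomain ϖ \ ⋃ m, cellTranslate ϖ m) = 0) {h : BochnerL2 ϖ}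
    (hh : ∀ (U : L2 (periodicDomain ϖ)) (hU : U ∈ decaySpace hϖ) (A : Set (ℝ × ℝ))
      (hA : MeasurableSet A), inner ℂ (memLp_indicator_decaySection hU.2 hA).toLp h = 0) :
    ∀ᵐ η ∂floquetMeasure, ∀ v ∈ quasiSpace ϖ η, inner ℂ v (h η) = 0 := by
  have h1 : ∀ U ∈ decaySpace hϖ, ∀ᵐ η ∂floquetMeasure, inner ℂ (decaySection ϖ U η) (h η) = 0 := by
    intro U hU
    have hL : MemLp (decaySection ϖ U) 2 floquetMeasure :=
      MemLp.of_bound (continuous_decaySection hU.2).aestronglyMeasurable _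
        (Eventually.of_forall (norm_decaySection_le hU.2))
    have hint : Integrable (fun η => inner ℂ (decaySection ϖ U η) (h η)) floquetMeasure := by
      refine (L2.integrable_inner (𝕜 := ℂ) hL.toLp h).congr ?_
      filter_upwards [hL.coeFn_toLp] with η hη
      rw [hη]
    -- Varying `A` localizes the vanishing of the integral to almost every `η`.
    refine Integrable.ae_eq_zero_of_forall_setIntegral_eq_zero hint fun A hA _ => ?_
    rw [← hh U hU A hA, L2.inner_def, ← integral_indicator hA]
    refine integral_congr_ae ?_
    filter_upwards [(memLp_indicator_decaySection hU.2 hA).coeFn_toLp] with η hη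
    rw [hη]
    by_cases hηA : η ∈ A
    · rw [indicator_of_mem hηA, indicator_of_mem hηA]
    · rw [indicator_of_notMem hηA, indicator_of_notMem hηA, inner_zero_left]
  have : Fact ((2 : ℝ≥0∞) ≠ ∞) := ⟨by simp⟩
  have : SecondCountableTopology (L2 ϖ) := inferInstance
  -- The exceptional null set depends on `U`. A countable dense set of continuous sections, for the
  -- compact-open topology, gives one null set for all, since evaluation at `η` is continuous.
  let 𝒮 : Set C(ℝ × ℝ, L2 ϖ) := {s | ∃ U ∈ decaySpace hϖ, ∀ η, s η = decaySection ϖ U η}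
  obtain ⟨T, hTc, hTd⟩ := TopologicalSpace.exists_countable_dense ↥𝒮
  have h2 : ∀ᵐ η ∂floquetMeasure, ∀ s ∈ T, inner ℂ (s.1 η) (h η) = 0 := by
    rw [ae_ball_iff hTc]
    rintro ⟨s, U, hU, hs⟩ -
    filter_upwards [h1 U hU] with η hη
    rw [← hη, ← hs]
  filter_upwards [h2] with η hη
  have h3 : ∀ s : 𝒮, inner ℂ (s.1 η) (h η) = 0 := by
    have hcl : IsClosed {s : 𝒮 | inner ℂ (s.1 η) (h η) = 0} := by
      refine isClosed_eq ?_ continuous_const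
      refine Continuous.inner ?_ continuous_const
      exact (continuous_eval_const (F := C(ℝ × ℝ, L2 ϖ)) η).comp continuous_subtype_val
    intro s
    exact closure_minimal (fun s hs => hη s hs) hcl (hTd s)
  -- Sections exhaust `A²_{η,ext}(ϖ)`, so orthogonality passes to this space and then to its
  -- closure.
  have h4 : (quasiExt ϖ η : Set (L2 ϖ)) ⊆ {v | inner ℂ v (h η) = 0} := by
    intro v hv
    obtain ⟨U, hU, rfl⟩ := exists_decaySection_eq hϖ hA hnull hv
    exact h3 ⟨⟨decaySection ϖ U, continuous_decaySection hU.2⟩, U, hU, fun _ => rfl⟩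
  intro v hv
  exact closure_minimal h4 (isClosed_eq (Continuous.inner continuous_id continuous_const)
    continuous_const) hv

/-- The fibre space is orthogonal to a function that is orthogonal to all sections. -/
theorem mem_orthogonal_fiberSpace (hϖ : IsPeriodicCell ϖ) (hA : ConditionA ϖ)
    (hnull : volume (periodicDomain ϖ \ ⋃ m, cellTranslate ϖ m) = 0) {h : BochnerL2 ϖ}
    (hh : ∀ (U : L2 (periodicDomain ϖ)) (hU : U ∈ decaySpace hϖ) (A : Set (ℝ × ℝ))
      (hA : MeasurableSet A), inner ℂ (memLp_indicator_decaySection hU.2 hA).toLp h = 0) :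
    h ∈ (fiberSpace ϖ)ᗮ := by
  rw [Submodule.mem_orthogonal]
  intro g hg
  rw [L2.inner_def, integral_eq_zero_of_ae]
  filter_upwards [ae_inner_quasiSpace_eq_zero hϖ hA hnull hh, hg] with η h1 h2
  exact h1 _ h2

theorem indicator_decaySection_mem_fiberSpace (hϖ : IsPeriodicCell ϖ)
    (hnull : volume (periodicDomain ϖ \ ⋃ m, cellTranslate ϖ m) = 0)
    {U : L2 (periodicDomain ϖ)} (hU : U ∈ decaySpace hϖ)
    {A : Set (ℝ × ℝ)} (hA : MeasurableSet A) :
    (memLp_indicator_decaySection hU.2 hA).toLp ∈ fiberSpace ϖ := by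
  change ∀ᵐ η ∂floquetMeasure,
    ((memLp_indicator_decaySection hU.2 hA).toLp : BochnerL2 ϖ) η ∈ quasiSpace ϖ η
  filter_upwards [(memLp_indicator_decaySection hU.2 hA).coeFn_toLp] with η hη
  rw [hη]
  by_cases hηA : η ∈ A
  · rw [indicator_of_mem hηA]
    exact Submodule.le_topologicalClosure _ (decaySection_mem_quasiExt hϖ hnull hU η)
  · rw [indicator_of_notMem hηA]; exact zero_mem _

/-- The orthogonal projection onto the fibre space acts fibrewise. -/
theorem starProjection_fiberSpace_ae_eq (hϖ : IsPeriodicCell ϖ) (hA : ConditionA ϖ)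
    (hnull : volume (periodicDomain ϖ \ ⋃ m, cellTranslate ϖ m) = 0) (g : BochnerL2 ϖ) :
    (fiberSpace ϖ).starProjection g =ᵐ[floquetMeasure] fun η => cellProj ϖ η (g η) := by
  have h1 : ∀ᵐ η ∂floquetMeasure, (fiberSpace ϖ).starProjection g η ∈ quasiSpace ϖ η :=
    Submodule.starProjection_apply_mem (fiberSpace ϖ) g
  have h2 := ae_inner_quasiSpace_eq_zero hϖ hA hnull (h := g - (fiberSpace ϖ).starProjection g)
    fun U hU A hA => (fiberSpace ϖ).inner_right_of_mem_orthogonal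
      (indicator_decaySection_mem_fiberSpace hϖ hnull hU hA)
      (Submodule.sub_starProjection_mem_orthogonal g)
  filter_upwards [h1, h2, Lp.coeFn_sub g ((fiberSpace ϖ).starProjection g)] with η h3 h4 h5
  rw [h5] at h4
  exact (Submodule.eq_starProjection_of_mem_orthogonal h3
    ((Submodule.mem_orthogonal _ _).2 h4)).symm

/-- Measurability in `η` comes from the agreement almost everywhere with an element of the Bochner
space, the projection onto the fibre space. -/
theorem memLp_cellProj (hϖ : IsPeriodicCell ϖ) (hA : ConditionA ϖ)
    (hnull : volume (periodicDomain ϖ \ ⋃ m, cellTranslate ϖ m) = 0) (g : BochnerL2 ϖ) :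
    MemLp (fun η => cellProj ϖ η (g η)) 2 floquetMeasure :=
  (Lp.memLp _).ae_eq (starProjection_fiberSpace_ae_eq hϖ hA hnull g)

theorem fiberProj_eq (hϖ : IsPeriodicCell ϖ) (hA : ConditionA ϖ)
    (hnull : volume (periodicDomain ϖ \ ⋃ m, cellTranslate ϖ m) = 0) (g : BochnerL2 ϖ) :
    fiberProj ϖ g = (fiberSpace ϖ).starProjection g := by
  rw [fiberProj, dif_pos (memLp_cellProj hϖ hA hnull g)]
  exact Lp.ext ((memLp_cellProj hϖ hA hnull g).coeFn_toLp.trans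
    (starProjection_fiberSpace_ae_eq hϖ hA hnull g).symm)

theorem floquetL_mem_fiberSpace (hϖ : IsPeriodicCell ϖ) (hA : ConditionA ϖ)
    (hnull : volume (periodicDomain ϖ \ ⋃ m, cellTranslate ϖ m) = 0) {f : L2 (periodicDomain ϖ)}
    (hf : f ∈ bergmanSpace (periodicDomain ϖ)) : floquetL hϖ hnull f ∈ fiberSpace ϖ := by
  have hcl : IsClosed (fiberSpace ϖ : Set (BochnerL2 ϖ)) :=
    isClosed_fiber (K := fun η => (quasiSpace ϖ η : Set (L2 ϖ)))
      fun _ => Submodule.isClosed_topologicalClosure _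
  refine closure_minimal (s := (decaySpace hϖ : Set (L2 (periodicDomain ϖ))))
    (t := floquetL hϖ hnull ⁻¹' (fiberSpace ϖ)) (fun U hU => ?_)
    (hcl.preimage (floquetL hϖ hnull).continuous)
    (bergmanSpace_le_closure_decaySpace hϖ hA hnull hf)
  change ∀ᵐ η ∂floquetMeasure, floquetL hϖ hnull U η ∈ quasiSpace ϖ η
  filter_upwards [floquetL_decay hϖ hnull hU] with η hη
  rw [hη]
  exact Submodule.smul_mem _ _
    (Submodule.le_topologicalClosure _ (decaySection_mem_quasiExt hϖ hnull hU η))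

/-- By duality: the adjoint takes cut-off sections into `A²(Ω)`, to which `f` is orthogonal. -/
theorem floquetL_mem_orthogonal (hϖ : IsPeriodicCell ϖ) (hA : ConditionA ϖ)
    (hnull : volume (periodicDomain ϖ \ ⋃ m, cellTranslate ϖ m) = 0) {f : L2 (periodicDomain ϖ)}
    (hf : f ∈ (bergmanSpace (periodicDomain ϖ))ᗮ) : floquetL hϖ hnull f ∈ (fiberSpace ϖ)ᗮ := by
  refine mem_orthogonal_fiberSpace hϖ hA hnull fun U hU A hA => ?_
  rw [← inner_conj_symm, ← inner_floquetAdj, inner_conj_symm]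
  exact Submodule.inner_right_of_mem_orthogonal
    (floquetAdj_indicator_decaySection_mem hϖ hnull hU hA) hf

/-- The closed space `A²(Ω)` is its own double orthogonal complement, so the statement is dual to
the inclusion for complements. -/
theorem floquetAdj_mem_bergmanSpace (hϖ : IsPeriodicCell ϖ) (hA : ConditionA ϖ)
    (hnull : volume (periodicDomain ϖ \ ⋃ m, cellTranslate ϖ m) = 0) {g : BochnerL2 ϖ}
    (hg : g ∈ fiberSpace ϖ) : floquetAdj hϖ hnull g ∈ bergmanSpace (periodicDomain ϖ) := by
  have := hasOrthogonalProjection_bergmanSpace (isOpen_periodicDomain ϖ)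
  rw [← Submodule.orthogonal_orthogonal (bergmanSpace (periodicDomain ϖ)), Submodule.mem_orthogonal]
  intro f hf
  rw [inner_floquetAdj]
  exact Submodule.inner_left_of_mem_orthogonal hg (floquetL_mem_orthogonal hϖ hA hnull hf)

/-- The Floquet transform intertwines the Bergman projection with the fibrewise projection. -/
theorem floquetL_bergmanProj (hϖ : IsPeriodicCell ϖ) (hA : ConditionA ϖ)
    (hnull : volume (periodicDomain ϖ \ ⋃ m, cellTranslate ϖ m) = 0) (f : L2 (periodicDomain ϖ)) :
    floquetL hϖ hnull (bergmanProj (periodicDomain ϖ) (isOpen_periodicDomain ϖ) f) =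
      (fiberSpace ϖ).starProjection (floquetL hϖ hnull f) := by
  have := hasOrthogonalProjection_bergmanSpace (isOpen_periodicDomain ϖ)
  refine (Submodule.eq_starProjection_of_mem_orthogonal
    (floquetL_mem_fiberSpace hϖ hA hnull (Submodule.starProjection_apply_mem _ f)) ?_).symm
  rw [← map_sub]
  exact floquetL_mem_orthogonal hϖ hA hnull (Submodule.sub_starProjection_mem_orthogonal f)

/-! ### Pointwise values and kernels. -/

theorem completeSpace_bergmanSpace {D : Set ℂ} (hD : IsOpen D) : CompleteSpace (bergmanSpace D) :=
  (isClosed_bergman hD).isComplete.completeSpace_coe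

theorem inner_evalVec_bergmanSpace {D : Set ℂ} (hD : IsOpen D) {z : ℂ} (hz : z ∈ D) {f : L2 D}
    (hf : f ∈ bergmanSpace D) : inner ℂ (evalVec (bergmanSpace D) z) f = holoRep D f z :=
  have := completeSpace_bergmanSpace hD
  (evalVec_spec hD (bergmanSpace D) le_rfl hz).2 f hf

/-- Evaluation on `A²_η(ϖ)` restricts the evaluation on `A²(ϖ)`. All dependence on `η` thus sits in
the projection, whose measurability is already known. -/
theorem evalVec_quasiSpace (hϖ : IsPeriodicCell ϖ) (η : ℝ × ℝ) {x : ℂ} (hx : x ∈ ϖ) :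
    evalVec (quasiSpace ϖ η) x = cellProj ϖ η (evalVec (bergmanSpace ϖ) x) := by
  refine evalVec_eq hϖ.isOpen _ (quasiSpace_le_bergmanSpace hϖ η) hx
    (Submodule.starProjection_apply_mem _ _) fun f hf => ?_
  rw [cellProj, Submodule.inner_starProjection_left_eq_right,
    Submodule.starProjection_eq_self_iff.2 hf,
    inner_evalVec_bergmanSpace hϖ.isOpen hx (quasiSpace_le_bergmanSpace hϖ η hf)]

/-- Expresses a value on `Ω` by a bounded functional on all of `L²(ϖ)`, which commutes with the
Bochner integral in `F⁻¹`. -/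
theorem holoRep_periodicDomain (hϖ : IsPeriodicCell ϖ) {f : L2 (periodicDomain ϖ)}
    (hf : f ∈ bergmanSpace (periodicDomain ϖ)) {z : ℂ} (hz : tr z ∈ ϖ) :
    holoRep (periodicDomain ϖ) f z =
      inner ℂ (evalVec (bergmanSpace ϖ) (tr z)) (cellPart ϖ (intPart z) f) := by
  obtain ⟨h1, h2⟩ := holoRep_spec (isOpen_periodicDomain ϖ) hf
  have h3 := cellPart_eq_of_ae hϖ (intPart z) h2
  have h4 : DifferentiableOn ℂ (fun x => holoRep (periodicDomain ϖ) f (x + lat (intPart z))) ϖ :=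
    h1.comp (by fun_prop) fun x hx => hϖ.add_lat_mem hx _
  rw [inner_evalVec_bergmanSpace hϖ.isOpen hz (mem_bergmanSpace h4 h3),
    holoRep_eq hϖ.isOpen h4 h3 hz, tr_add_lat_intPart]

theorem ae_holoRep_eq_inner (hϖ : IsPeriodicCell ϖ) {g : BochnerL2 ϖ} (hg : g ∈ fiberSpace ϖ)
    {x : ℂ} (hx : x ∈ ϖ) : ∀ᵐ η ∂floquetMeasure,
      inner ℂ (evalVec (bergmanSpace ϖ) x) (g η) = holoRep ϖ (g η) x := by
  have hg' : ∀ᵐ η ∂floquetMeasure, g η ∈ quasiSpace ϖ η := hg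
  filter_upwards [hg'] with η hη
  exact inner_evalVec_bergmanSpace hϖ.isOpen hx (quasiSpace_le_bergmanSpace hϖ η hη)

theorem integrable_exp_mul_holoRep (hϖ : IsPeriodicCell ϖ) {g : BochnerL2 ϖ}
    (hg : g ∈ fiberSpace ϖ) {x : ℂ} (hx : x ∈ ϖ) (n : ℤ × ℤ) :
    Integrable (fun η => Complex.exp (Complex.I * pairing n η) * holoRep ϖ (g η) x)
      floquetMeasure := by
  refine (integrable_exp_smul ((integrable_coe g).const_inner
    (evalVec (bergmanSpace ϖ) x)) n).congr ?_
  filter_upwards [ae_holoRep_eq_inner hϖ hg hx] with η hη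
  rw [hη, smul_eq_mul]

theorem inner_cellPart_floquetAdj (hϖ : IsPeriodicCell ϖ)
    (hnull : volume (periodicDomain ϖ \ ⋃ m, cellTranslate ϖ m) = 0) (n : ℤ × ℤ) (k : L2 ϖ)
    (g : BochnerL2 ϖ) : inner ℂ k (cellPart ϖ n (floquetAdj hϖ hnull g)) =
      1 / (2 * Real.pi) *
        ∫ η, Complex.exp (Complex.I * pairing n η) * inner ℂ k (g η) ∂floquetMeasure := by
  rw [cellPart_floquetAdj, inner_smul_right,
    ← integral_inner (integrable_exp_smul (integrable_coe g) n)]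
  simp only [inner_smul_right]

/-- Pointwise values of the inverse Floquet transform. -/
theorem holoRep_floquetAdj (hϖ : IsPeriodicCell ϖ) (hA : ConditionA ϖ)
    (hnull : volume (periodicDomain ϖ \ ⋃ m, cellTranslate ϖ m) = 0) {g : BochnerL2 ϖ}
    (hg : g ∈ fiberSpace ϖ) {z : ℂ} (hz : tr z ∈ ϖ) :
    holoRep (periodicDomain ϖ) (floquetAdj hϖ hnull g) z = 1 / (2 * Real.pi) *
      ∫ η, Complex.exp (Complex.I * pairing (intPart z) η) * holoRep ϖ (g η) (tr z)
        ∂floquetMeasure := by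
  rw [holoRep_periodicDomain hϖ (floquetAdj_mem_bergmanSpace hϖ hA hnull hg) hz,
    inner_cellPart_floquetAdj]
  congr 1
  refine integral_congr_ae ?_
  filter_upwards [ae_holoRep_eq_inner hϖ hg hz] with η hη
  rw [hη]

theorem bergmanProj_eq_floquetAdj (hϖ : IsPeriodicCell ϖ) (hA : ConditionA ϖ)
    (hnull : volume (periodicDomain ϖ \ ⋃ m, cellTranslate ϖ m) = 0) (f : L2 (periodicDomain ϖ)) :
    bergmanProj (periodicDomain ϖ) (isOpen_periodicDomain ϖ) f =
      floquetAdj hϖ hnull ((fiberSpace ϖ).starProjection (floquetL hϖ hnull f)) := by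
  rw [← floquetL_bergmanProj hϖ hA hnull, floquetAdj_floquetL]

/-- The section `η ↦ exp(-i η·n) K_η(x, ·)^*`. -/
def kernelSection (ϖ : Set ℂ) (n : ℤ × ℤ) (x : ℂ) : BochnerL2 ϖ :=
  (fiberSpace ϖ).starProjection (memLp_mode ϖ n (evalVec (bergmanSpace ϖ) x)).toLp

theorem kernelSection_mem (ϖ : Set ℂ) (n : ℤ × ℤ) (x : ℂ) : kernelSection ϖ n x ∈ fiberSpace ϖ :=
  Submodule.starProjection_apply_mem _ _

theorem kernelSection_ae_eq (hϖ : IsPeriodicCell ϖ) (hA : ConditionA ϖ)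
    (hnull : volume (periodicDomain ϖ \ ⋃ m, cellTranslate ϖ m) = 0) (n : ℤ × ℤ) {x : ℂ}
    (hx : x ∈ ϖ) : kernelSection ϖ n x =ᵐ[floquetMeasure] fun η =>
      Complex.exp (-(Complex.I * pairing n η)) • evalVec (quasiSpace ϖ η) x := by
  filter_upwards [starProjection_fiberSpace_ae_eq hϖ hA hnull
    (memLp_mode ϖ n (evalVec (bergmanSpace ϖ) x)).toLp,
    (memLp_mode ϖ n (evalVec (bergmanSpace ϖ) x)).coeFn_toLp] with η h1 h2
  rw [kernelSection, h1, h2, map_smul, evalVec_quasiSpace hϖ η hx]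

theorem holoRep_kernelSection (hϖ : IsPeriodicCell ϖ) (hA : ConditionA ϖ)
    (hnull : volume (periodicDomain ϖ \ ⋃ m, cellTranslate ϖ m) = 0) (n : ℤ × ℤ) {x y : ℂ}
    (hx : x ∈ ϖ) (hy : y ∈ ϖ) : ∀ᵐ η ∂floquetMeasure, holoRep ϖ (kernelSection ϖ n x η) y =
      Complex.exp (-(Complex.I * pairing n η)) * starRingEnd ℂ (cellKernel ϖ η x y) := by
  filter_upwards [kernelSection_ae_eq hϖ hA hnull n hx,
    ae_holoRep_eq_inner hϖ (kernelSection_mem ϖ n x) hy] with η h1 h2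
  have h3 := (evalVec_spec hϖ.isOpen _ (quasiSpace_le_bergmanSpace hϖ η) hx).1
  rw [← h2, h1, inner_smul_right, inner_evalVec_bergmanSpace hϖ.isOpen hy
    (quasiSpace_le_bergmanSpace hϖ η h3), cellKernel, reproKernel, Complex.conj_conj]

theorem integrable_cellKernel (hϖ : IsPeriodicCell ϖ) (hA : ConditionA ϖ)
    (hnull : volume (periodicDomain ϖ \ ⋃ m, cellTranslate ϖ m) = 0) {x y : ℂ}
    (hx : x ∈ ϖ) (hy : y ∈ ϖ) : Integrable (fun η => cellKernel ϖ η x y) floquetMeasure := by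
  have h := integrable_exp_mul_holoRep hϖ (kernelSection_mem ϖ 0 x) hy 0
  refine (Complex.conjCLE.toContinuousLinearMap.integrable_comp h).congr ?_
  filter_upwards [holoRep_kernelSection hϖ hA hnull 0 hx hy] with η hη
  simp [hη]

/-- The Riesz representative of the evaluation at `z` in the Bergman space of `Ω`. -/
theorem evalVec_periodicDomain (hϖ : IsPeriodicCell ϖ) (hA : ConditionA ϖ)
    (hnull : volume (periodicDomain ϖ \ ⋃ m, cellTranslate ϖ m) = 0) {z : ℂ}
    (hz : z ∈ periodicDomain ϖ) (hz' : tr z ∈ ϖ) :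
    evalVec (bergmanSpace (periodicDomain ϖ)) z =
      (1 / (2 * Real.pi) : ℂ) • floquetAdj hϖ hnull (kernelSection ϖ (intPart z) (tr z)) := by
  have := completeSpace_bergmanSpace (isOpen_periodicDomain ϖ)
  refine evalVec_eq (isOpen_periodicDomain ϖ) _ le_rfl hz (Submodule.smul_mem _ _
    (floquetAdj_mem_bergmanSpace hϖ hA hnull (kernelSection_mem ϖ _ _))) fun f hf => ?_
  -- Since `F f` lies in the fibre space, the projection in `kernelSection` can be dropped, leaving
  -- the pairing of a mode with `F f`, that is, the inverse transform evaluated at `z`.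
  rw [inner_smul_left, ← inner_conj_symm, inner_floquetAdj, inner_conj_symm, kernelSection,
    Submodule.inner_starProjection_left_eq_right,
    Submodule.starProjection_eq_self_iff.2 (floquetL_mem_fiberSpace hϖ hA hnull hf), inner_mode,
    holoRep_periodicDomain hϖ hf hz']
  have h := inner_cellPart_floquetAdj hϖ hnull (intPart z) (evalVec (bergmanSpace ϖ) (tr z))
    (floquetL hϖ hnull f)
  rw [floquetAdj_floquetL] at h
  rw [h]
  simp [map_ofNat]

theorem reproKernel_periodicDomain (hϖ : IsPeriodicCell ϖ) (hA : ConditionA ϖ)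
    (hnull : volume (periodicDomain ϖ \ ⋃ m, cellTranslate ϖ m) = 0) {z w : ℂ}
    (hz : z ∈ periodicDomain ϖ) (hz' : tr z ∈ ϖ) (hw : w ∈ periodicDomain ϖ) (hw' : tr w ∈ ϖ) :
    reproKernel (bergmanSpace (periodicDomain ϖ)) z w = 1 / (4 * Real.pi ^ 2) *
      ∫ η, Complex.exp (Complex.I * pairing (intPart z - intPart w) η) *
        cellKernel ϖ η (tr z) (tr w) ∂floquetMeasure := by
  have hO := isOpen_periodicDomain ϖ
  have hmem := floquetAdj_mem_bergmanSpace hϖ hA hnull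
    (kernelSection_mem ϖ (intPart z) (tr z))
  have h1 : holoRep (periodicDomain ϖ) (evalVec (bergmanSpace (periodicDomain ϖ)) z) w =
      1 / (4 * Real.pi ^ 2) * ∫ η, Complex.exp (Complex.I * pairing (intPart w) η) *
        holoRep ϖ (kernelSection ϖ (intPart z) (tr z) η) (tr w) ∂floquetMeasure := by
    -- The constant `1 / (4π²)` is the product of two factors `1 / (2π)`: one from the evaluation
    -- vector, one from the inverse transform.
    rw [evalVec_periodicDomain hϖ hA hnull hz hz',
      ← inner_evalVec_bergmanSpace hO hw (Submodule.smul_mem _ _ hmem), inner_smul_right,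
      inner_evalVec_bergmanSpace hO hw hmem,
      holoRep_floquetAdj hϖ hA hnull (kernelSection_mem ϖ _ _) hw', ← mul_assoc]
    congr 1
    field_simp
    norm_num
  rw [reproKernel, h1, map_mul, ← integral_conj]
  congr 1
  · simp [map_ofNat]
  · refine integral_congr_ae ?_
    filter_upwards [holoRep_kernelSection hϖ hA hnull (intPart z) hz' hw'] with η hη
    rw [hη, ← mul_assoc, ← Complex.exp_add, map_mul, Complex.conj_conj, ← Complex.exp_conj,
      pairing_sub]
    congr 2
    simp
    ring

end FloquetBergman

end

theorem theorem4p1 (ϖ : Set ℂ) (hϖ : IsPeriodicCell ϖ) (hA : ConditionA ϖ)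
    -- up to a null set, the periodic domain is the union of the translated cells
    (hnull : volume (periodicDomain ϖ \ ⋃ m, cellTranslate ϖ m) = 0) :
    -- (i) the fibrewise operator is well defined and is the orthogonal projection
    ((∀ g : BochnerL2 ϖ, MemLp (fun η => cellProj ϖ η (g η)) 2 floquetMeasure) ∧
      ∀ g : BochnerL2 ϖ, fiberProj ϖ g = (fiberSpace ϖ).starProjection g) ∧
    -- the functions `K_η` are the kernels of the projections `P_η`
    (∀ η ∈ floquetSquare, ∀ z ∈ ϖ, MemLp (cellKernel ϖ η z) 2 (volume.restrict ϖ) ∧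
      ∀ f : L2 ϖ, holoRep ϖ (cellProj ϖ η f) z = ∫ w in ϖ, cellKernel ϖ η z w * f w) ∧
    -- (ii) the Bergman projection is `F⁻¹ 𝒫 F`
    (∀ f : L2 (periodicDomain ϖ),
      floquet ϖ (bergmanProj (periodicDomain ϖ) (isOpen_periodicDomain ϖ) f)
        = fiberProj ϖ (floquet ϖ f) ∧
      bergmanProj (periodicDomain ϖ) (isOpen_periodicDomain ϖ) f
        =ᵐ[volume.restrict (periodicDomain ϖ)] floquetInv ϖ (fiberProj ϖ (floquet ϖ f))) ∧
    -- the pointwise formula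
    (∀ f : L2 (periodicDomain ϖ), ∀ z ∈ periodicDomain ϖ, tr z ∈ ϖ →
      Integrable (fun η => Complex.exp (Complex.I * pairing (intPart z) η) *
        holoRep ϖ (cellProj ϖ η (floquet ϖ f η)) (tr z)) floquetMeasure ∧
      holoRep (periodicDomain ϖ)
          (bergmanProj (periodicDomain ϖ) (isOpen_periodicDomain ϖ) f) z
        = 1 / (2 * Real.pi) * ∫ η, Complex.exp (Complex.I * pairing (intPart z) η) *
            holoRep ϖ (cellProj ϖ η (floquet ϖ f η)) (tr z) ∂floquetMeasure) ∧
    -- the kernel formula; the inner integral over `η` is computed first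
    (∀ z ∈ periodicDomain ϖ, tr z ∈ ϖ →
      (∀ w ∈ periodicDomain ϖ, tr w ∈ ϖ →
        Integrable (fun η => cellKernel ϖ η (tr z) (tr w)) floquetMeasure) ∧
      MemLp (fun w => ∫ η, Complex.exp (Complex.I * pairing (intPart z - intPart w) η) *
        cellKernel ϖ η (tr z) (tr w) ∂floquetMeasure) 2 (volume.restrict (periodicDomain ϖ)) ∧
      (∀ f : L2 (periodicDomain ϖ),
        holoRep (periodicDomain ϖ)
            (bergmanProj (periodicDomain ϖ) (isOpen_periodicDomain ϖ) f) z
          = 1 / (4 * Real.pi ^ 2) * ∫ w in periodicDomain ϖ, ∫ η,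
              Complex.exp (Complex.I * pairing (intPart z - intPart w) η) *
                cellKernel ϖ η (tr z) (tr w) * f w ∂floquetMeasure) ∧
      (∀ w ∈ periodicDomain ϖ, tr w ∈ ϖ →
        reproKernel (bergmanSpace (periodicDomain ϖ)) z w
          = 1 / (4 * Real.pi ^ 2) * ∫ η,
              Complex.exp (Complex.I * pairing (intPart z - intPart w) η) *
                cellKernel ϖ η (tr z) (tr w) ∂floquetMeasure)) := by
  have hO := isOpen_periodicDomain ϖ
  have hcomp := completeSpace_bergmanSpace hO
  refine ⟨⟨memLp_cellProj hϖ hA hnull, fiberProj_eq hϖ hA hnull⟩, fun η _ z hz =>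
    ⟨memLp_reproKernel hϖ.isOpen _ (quasiSpace_le_bergmanSpace hϖ η) hz, fun f =>
      (integral_reproKernel hϖ.isOpen _ (quasiSpace_le_bergmanSpace hϖ η) hz f).symm⟩,
    fun f => ⟨?_, ?_⟩, fun f z hz hz' => ?_, fun z hz hz' => ?_⟩
  · rw [floquet_eq hϖ hnull, floquet_eq hϖ hnull, fiberProj_eq hϖ hA hnull,
      floquetL_bergmanProj hϖ hA hnull]
  · rw [floquet_eq hϖ hnull, fiberProj_eq hϖ hA hnull, bergmanProj_eq_floquetAdj hϖ hA hnull]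
    exact floquetInv_ae_eq hϖ hnull _
  · have hg := Submodule.starProjection_apply_mem (fiberSpace ϖ) (floquetL hϖ hnull f)
    have hae : (fun η => Complex.exp (Complex.I * pairing (intPart z) η) *
        holoRep ϖ ((fiberSpace ϖ).starProjection (floquetL hϖ hnull f) η) (tr z))
        =ᵐ[floquetMeasure] fun η => Complex.exp (Complex.I * pairing (intPart z) η) *
          holoRep ϖ (cellProj ϖ η (floquetL hϖ hnull f η)) (tr z) := by
      filter_upwards [starProjection_fiberSpace_ae_eq hϖ hA hnull (floquetL hϖ hnull f)] with η hη
      rw [hη]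
    rw [floquet_eq hϖ hnull]
    refine ⟨(integrable_exp_mul_holoRep hϖ hg hz' _).congr hae, ?_⟩
    rw [bergmanProj_eq_floquetAdj hϖ hA hnull, holoRep_floquetAdj hϖ hA hnull hg hz',
      integral_congr_ae hae]
  · have hpi : (4 * Real.pi ^ 2 : ℂ) ≠ 0 := by
      have : (Real.pi : ℂ) ≠ 0 := by exact_mod_cast Real.pi_ne_zero
      simp [this]
    -- Fubini's theorem is not needed: the inner integral over `η` is a multiple of the Bergman
    -- kernel of `Ω` for almost every `w`. Square integrability in `w` and the integral formula are
    -- then the properties of that kernel.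
    have hker : ∀ᵐ w ∂(volume.restrict (periodicDomain ϖ)),
        ∫ η, Complex.exp (Complex.I * pairing (intPart z - intPart w) η) *
          cellKernel ϖ η (tr z) (tr w) ∂floquetMeasure =
        4 * Real.pi ^ 2 * reproKernel (bergmanSpace (periodicDomain ϖ)) z w := by
      filter_upwards [hϖ.ae_tr_mem hnull, ae_restrict_mem hO.measurableSet] with w hw' hw
      rw [reproKernel_periodicDomain hϖ hA hnull hz hz' hw hw', ← mul_assoc, mul_one_div_cancel hpi,
        one_mul]
    refine ⟨fun w _ hw' => integrable_cellKernel hϖ hA hnull hz' hw', ?_, fun f => ?_,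
      fun w hw hw' => reproKernel_periodicDomain hϖ hA hnull hz hz' hw hw'⟩
    · refine ((memLp_reproKernel hO _ le_rfl hz).const_mul (4 * Real.pi ^ 2 : ℂ)).ae_eq ?_
      filter_upwards [hker] with w hw using hw.symm
    · have h1 := integral_reproKernel hO (bergmanSpace (periodicDomain ϖ)) le_rfl hz f
      have h2 : holoRep (periodicDomain ϖ) (bergmanProj (periodicDomain ϖ) hO f) z =
          ∫ w in periodicDomain ϖ, reproKernel (bergmanSpace (periodicDomain ϖ)) z w * f w :=
        h1.symm
      rw [h2, ← integral_const_mul]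
      refine integral_congr_ae ?_
      filter_upwards [hker] with w hw
      rw [integral_mul_const, hw, ← mul_assoc, ← mul_assoc, one_div_mul_cancel hpi, one_mul]
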